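/- Let $(M,g)$ be a smooth Hausdorff $n$-dimensional Riemannian manifold with Levi-Civita connection $\nabla$ (Christoffel symbols $\Gamma$), $\pi:TM\to M$ its tangent bundle, with induced coordinates $(x^r,u^r)$, and let $v^h, v^v$ denote the horizontal and vertical lifts to $T_{(x,u)}TM$ of $v\in T_xM$ with respect to $\nabla$. Let $G$ be the $g$-natural metric on $TM$ with coefficient functions $a_j,b_j:[0,\infty)\to\mathbb R$ $(j=1,2,3)$, that is, with $r^2=g_x(u,u)$, $$G_{(x,u)}(v^h,w^h)=(a_1+a_3)(r^2)\,g_x(v,w)+(b_1+b_3)(r^2)\,g_x(v,u)g_x(w,u),$$ $$G_{(x,u)}(v^h,w^v)=G_{(x,u)}(v^v,w^h)=a_2(r^2)\,g_x(v,w)+b_2(r^2)\,g_x(v,u)g_x(w,u),$$ $$G_{(x,u)}(v^v,w^v)=a_1(r^2)\,g_x(v,w)+b_1(r^2)\,g_x(v,u)g_x(w,u).$$ **Theorem.** Let $X$ be a smooth vector field on an open set $U\subset M$ which is an infinitesimal affine transformation, i.e. $L_X\Gamma^h_{ji}=0$ on $U$. Suppose that $a_2$ is a nonzero constant, $b_3$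 is a constant, and $a_1=a_3=b_1=b_2=0$. Then the vector field $\iota C^{[X]}+X^C$ is a Killing vector field for $G$ on $\pi^{-1}(U)$, i.e. it is smooth and $L_{\iota C^{[X]}+X^C}G=0$ there. Here, in induced coordinates, $$X^C=X^r\frac{\partial}{\partial x^r}+u^s\,\frac{\partial X^r}{\partial x^s}\frac{\partial}{\partial u^r},\qquad \iota C^{[X]}=u^k\,(C^{[X]})^h_k\,\frac{\partial}{\partial u^h},\qquad (C^{[X]})^h_k=-g^{hr}(L_Xg)_{rk}.$$ -/

import Mathlib

open scoped Manifold ContDiff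
open Bundle

noncomputable section

namespace GNat

/-! ### Lie derivatives on a boundaryless manifold -/

section General

variable {F : Type*} [NormedAddCommGroup F] [NormedSpace ℝ F]
  {H : Type*} [TopologicalSpace H] (I : ModelWithCorners ℝ F H)
  {N : Type*} [TopologicalSpace N] [ChartedSpace H N] [IsManifold I 1 N]

/-- The components, as a function on the model space, of the vector field `Z` in the preferred
chart at `p`. -/
def fieldInChart (Z : ∀ q : N, TangentSpace I q) (p : N) (y : F) : F :=
  (trivializationAt F (TangentSpace I : N → Type _) p).continuousLinearMapAt ℝ
    ((extChartAt I p).symm y) (Z ((extChartAt I p).symm y))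

/-- The components of the `(0,2)`-tensor field `T` (a bilinear
form on each tangent space) in the preferred chart at `p`: the value of `T`
on the two coordinate vector fields with constant components `v` and `w`. -/
def tensorInChart (T : ∀ q : N, TangentSpace I q → TangentSpace I q → ℝ) (p : N)
    (y : F) (v w : F) : ℝ :=
  T ((extChartAt I p).symm y)
    ((trivializationAt F (TangentSpace I : N → Type _) p).symmL ℝ ((extChartAt I p).symm y) v)
    ((trivializationAt F (TangentSpace I : N → Type _) p).symmL ℝ ((extChartAt I p).symm y) w)

/-- The Lie derivative `(L_Z T)_p(v, w)` of a smooth `(0,2)`-tensor field on a boundaryless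
manifold, written in the preferred chart at `p` as
`(L_Z T)_{ij} = Z^k ∂_k T_{ij} + T_{kj} ∂_i Z^k + T_{ik} ∂_j Z^k`. -/
def lieDerivTensor [I.Boundaryless] (Z : ∀ q : N, TangentSpace I q)
    (T : ∀ q : N, TangentSpace I q → TangentSpace I q → ℝ) (p : N)
    (v w : TangentSpace I p) : ℝ :=
  fderiv ℝ (fun y : F => tensorInChart I T p y v w) (extChartAt I p p) (Z p)
    + T p (fderiv ℝ (fieldInChart I Z p) (extChartAt I p p) v) w
    + T p v (fderiv ℝ (fieldInChart I Z p) (extChartAt I p p) w)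

/-- `Z` is a (smooth) Killing vector field on the open set `S` for the metric tensor `T`. -/
def IsKillingOn [I.Boundaryless] (T : ∀ q : N, TangentSpace I q → TangentSpace I q → ℝ)
    (Z : ∀ q : N, TangentSpace I q) (S : Set N) : Prop :=
  ContMDiffOn I I.tangent ∞ (fun q => (⟨q, Z q⟩ : TangentBundle I N)) S ∧
    ∀ p ∈ S, ∀ v w : TangentSpace I p, lieDerivTensor I Z T p v w = 0

end General

/-! ### The Levi-Civita connection in coordinates -/

section Riemannian

/-- The coordinate vector `∂_i`. -/
abbrev basisVec {n : ℕ} (i : Fin n) : EuclideanSpace ℝ (Fin n) := EuclideanSpace.single i 1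

/-- The partial derivative `∂_i f`. -/
abbrev pderiv {n : ℕ} (i : Fin n) (f : EuclideanSpace ℝ (Fin n) → ℝ)
    (y : EuclideanSpace ℝ (Fin n)) : ℝ :=
  fderiv ℝ f y (basisVec i)

variable {n : ℕ} {M : Type*} [TopologicalSpace M] [ChartedSpace (EuclideanSpace ℝ (Fin n)) M]
  [IsManifold (𝓡 n) ∞ M]

/-- The matrix `g_{ij}` of the metric in the preferred chart at `x`. -/
def metricMatrix
    (g : ContMDiffRiemannianMetric (𝓡 n) ∞ (EuclideanSpace ℝ (Fin n))
      (TangentSpace (𝓡 n) : M → Type _)) (x : M)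
    (y : EuclideanSpace ℝ (Fin n)) : Matrix (Fin n) (Fin n) ℝ :=
  Matrix.of fun i j => tensorInChart (𝓡 n) (fun q v w => g.inner q v w) x y (basisVec i) (basisVec j)

/-- The Christoffel symbol `Γ^k_{ij}` of the Levi-Civita connection in the preferred chart at
`x`. -/
def christoffel
    (g : ContMDiffRiemannianMetric (𝓡 n) ∞ (EuclideanSpace ℝ (Fin n))
      (TangentSpace (𝓡 n) : M → Type _)) (x : M)
    (k i j : Fin n) (y : EuclideanSpace ℝ (Fin n)) : ℝ :=
  (1 / 2 : ℝ) * ∑ l, (metricMatrix g x y)⁻¹ k l *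
    (pderiv i (fun z => metricMatrix g x z j l) y + pderiv j (fun z => metricMatrix g x z i l) y
      - pderiv l (fun z => metricMatrix g x z i j) y)

/-- The component `(L_X Γ)^h_{ji}` at `x` of the Lie derivative of the Levi-Civita connection,
in the preferred chart at `x`:
`X^r ∂_r Γ^h_{ji} + ∂_j ∂_i X^h - Γ^r_{ji} ∂_r X^h + Γ^h_{ri} ∂_j X^r + Γ^h_{jr} ∂_i X^r`. -/
def lieDerivChristoffel
    (g : ContMDiffRiemannianMetric (𝓡 n) ∞ (EuclideanSpace ℝ (Fin n))
      (TangentSpace (𝓡 n) : M → Type _))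
    (X : ∀ x : M, TangentSpace (𝓡 n) x) (x : M) (h j i : Fin n) : ℝ :=
  let y₀ : EuclideanSpace ℝ (Fin n) := extChartAt (𝓡 n) x x
  let Xc : Fin n → EuclideanSpace ℝ (Fin n) → ℝ := fun r y => fieldInChart (𝓡 n) X x y r
  (∑ r, Xc r y₀ * pderiv r (christoffel g x h j i) y₀)
    + pderiv j (fun y => pderiv i (Xc h) y) y₀
    - (∑ r, christoffel g x r j i y₀ * pderiv r (Xc h) y₀)
    + (∑ r, christoffel g x h r i y₀ * pderiv j (Xc r) y₀)
    + (∑ r, christoffel g x h j r y₀ * pderiv i (Xc r) y₀)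

/-- `X` is a (smooth) infinitesimal affine transformation on the open set `U`: `L_X Γ = 0`. -/
def IsInfinitesimalAffineOn
    (g : ContMDiffRiemannianMetric (𝓡 n) ∞ (EuclideanSpace ℝ (Fin n))
      (TangentSpace (𝓡 n) : M → Type _))
    (X : ∀ x : M, TangentSpace (𝓡 n) x) (U : Set M) : Prop :=
  ContMDiffOn (𝓡 n) (𝓡 n).tangent ∞ (fun x => (⟨x, X x⟩ : TangentBundle (𝓡 n) M)) U ∧
    ∀ x ∈ U, ∀ h j i : Fin n, lieDerivChristoffel g X x h j i = 0

/-! ### The tangent bundle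

The chart of `TM` at `(x, u)` is the one induced by the preferred chart of `M` at `x`. A tangent
vector of `TM` at `(x, u)` is therefore a pair `(ξ, η)`, which stands for
`ξ^j ∂/∂x^j + η^j ∂/∂u^j`. -/

/-- The differential of the projection, `dπ : T_{(x,u)}TM → T_xM`, `(ξ, η) ↦ ξ`. -/
def dProj (p : TangentBundle (𝓡 n) M) :
    TangentSpace (𝓡 n).tangent p →L[ℝ] TangentSpace (𝓡 n) p.proj :=
  ContinuousLinearMap.fst ℝ (EuclideanSpace ℝ (Fin n)) (EuclideanSpace ℝ (Fin n))

/-- The connection map `K : T_{(x,u)}TM → T_xM`, `(ξ, η) ↦ η^k + Γ^k_{ij} ξ^i u^j`. The horizontal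
lift of `v` to `(x, u)` is the vector `V` with `dπ V = v`, `K V = 0`, and the vertical lift of `v`
is the vector `V` with `dπ V = 0`, `K V = v`. -/
def connectionMap
    (g : ContMDiffRiemannianMetric (𝓡 n) ∞ (EuclideanSpace ℝ (Fin n))
      (TangentSpace (𝓡 n) : M → Type _)) (p : TangentBundle (𝓡 n) M) :
    TangentSpace (𝓡 n).tangent p →L[ℝ] TangentSpace (𝓡 n) p.proj :=
  ContinuousLinearMap.snd ℝ (EuclideanSpace ℝ (Fin n)) (EuclideanSpace ℝ (Fin n)) +
    (Matrix.toEuclideanCLM (n := Fin n) (𝕜 := ℝ) (Matrix.of fun k i =>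
      ∑ j, christoffel g p.proj k i j (extChartAt (𝓡 n) p.proj p.proj) *
        (show EuclideanSpace ℝ (Fin n) from p.snd) j)).comp
      (ContinuousLinearMap.fst ℝ (EuclideanSpace ℝ (Fin n)) (EuclideanSpace ℝ (Fin n)))

/-- The `g`-natural metric on `TM` with coefficient functions `a₁, a₂, a₃, b₁, b₂, b₃`, of which
only the values on `[0, ∞)` matter. With `r² = g(u, u)` it is the bilinear form on `T_{(x,u)}TM`
determined by
`G(v^h, w^h) = (a₁ + a₃)(r²) g(v, w) + (b₁ + b₃)(r²) g(v, u) g(w, u)`,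
`G(v^h, w^v) = G(v^v, w^h) = a₂(r²) g(v, w) + b₂(r²) g(v, u) g(w, u)`,
`G(v^v, w^v) = a₁(r²) g(v, w) + b₁(r²) g(v, u) g(w, u)`. -/
def gNaturalMetric
    (g : ContMDiffRiemannianMetric (𝓡 n) ∞ (EuclideanSpace ℝ (Fin n))
      (TangentSpace (𝓡 n) : M → Type _))
    (a₁ a₂ a₃ b₁ b₂ b₃ : ℝ → ℝ) (p : TangentBundle (𝓡 n) M)
    (V W : TangentSpace (𝓡 n).tangent p) : ℝ :=
  let u := p.snd
  let gx : TangentSpace (𝓡 n) p.proj → TangentSpace (𝓡 n) p.proj → ℝ :=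
    fun v w => g.inner p.proj v w
  let D := dProj p
  let K := connectionMap g p
  ((a₁ (gx u u) + a₃ (gx u u)) * gx (D V) (D W)
      + (b₁ (gx u u) + b₃ (gx u u)) * gx (D V) u * gx (D W) u)
    + (a₂ (gx u u) * gx (D V) (K W) + b₂ (gx u u) * gx (D V) u * gx (K W) u)
    + (a₂ (gx u u) * gx (K V) (D W) + b₂ (gx u u) * gx (K V) u * gx (D W) u)
    + (a₁ (gx u u) * gx (K V) (K W) + b₁ (gx u u) * gx (K V) u * gx (K W) u)

/-- The complete lift `X^C = X^r ∂/∂x^r + u^s (∂_s X^r) ∂/∂u^r`. -/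
def completeLift (X : ∀ x : M, TangentSpace (𝓡 n) x) (p : TangentBundle (𝓡 n) M) :
    TangentSpace (𝓡 n).tangent p :=
  ((X p.proj, fderiv ℝ (fieldInChart (𝓡 n) X p.proj) (extChartAt (𝓡 n) p.proj p.proj) p.snd) :
    EuclideanSpace ℝ (Fin n) × EuclideanSpace ℝ (Fin n))

/-- The `(1,1)`-tensor field `C^{[X]}`, `C^h_k = -g^{hr} (L_X g)_{rk}`, at `x`. -/
def tensorC
    (g : ContMDiffRiemannianMetric (𝓡 n) ∞ (EuclideanSpace ℝ (Fin n))
      (TangentSpace (𝓡 n) : M → Type _))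
    (X : ∀ x : M, TangentSpace (𝓡 n) x) (x : M) :
    TangentSpace (𝓡 n) x →L[ℝ] TangentSpace (𝓡 n) x :=
  Matrix.toEuclideanCLM (n := Fin n) (𝕜 := ℝ) (Matrix.of fun h k =>
    -∑ r, (metricMatrix g x (extChartAt (𝓡 n) x x))⁻¹ h r *
      lieDerivTensor (𝓡 n) X (fun q v w => g.inner q v w) x (basisVec r) (basisVec k))

/-- The `ι`-lift `ιP = u^k P^h_k ∂/∂u^h` of a `(1,1)`-tensor field `P`. -/
def iotaLift (P : ∀ x : M, TangentSpace (𝓡 n) x →L[ℝ] TangentSpace (𝓡 n) x)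
    (p : TangentBundle (𝓡 n) M) : TangentSpace (𝓡 n).tangent p :=
  ((0, P p.proj p.snd) : EuclideanSpace ℝ (Fin n) × EuclideanSpace ℝ (Fin n))

end Riemannian

end GNat

end

/-! With these coefficients $G=\beta\,\theta\otimes\theta+\alpha\,g^C$, where
$\theta=g(u,d\pi\,\cdot)$ and $g^C$ is the complete lift of $g$: the Christoffel terms of the
connection map combine to $u^k\partial_k g_{ij}$ (`gNaturalMetric_eq_metricLift`). Put $S=L_Xg$ and
$C=-g^{-1}S$. Then $L_{X^C}\theta=S(u,\cdot)$ and $L_{\iota C}\theta=g(Cu,\cdot)=-S(u,\cdot)$, so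
$\theta$ is invariant. Likewise $L_{X^C}g^C=S^C$; the mixed components of $S^C$ are cancelled by
$\iota C$, and what remains is the horizontal part
$u^k(\nabla_kS_{ij}-\nabla_iS_{jk}-\nabla_jS_{ik})=-2u_h(L_X\Gamma)^h_{ij}=0$. This computation is
`lieDeriv_metricLift_eq_zero`, resting on `fderiv_lieForm_of_lieChristoffelMap_eq_zero`; it takes
place in one chart, for a field of bilinear forms on a normed space.

The metric and the lifted field are defined at each point through that point's own preferred chart,
whereas a Lie derivative needs their components in one fixed chart on a whole neighbourhood. Hence
the transformation laws `metricLift_pullback` and `fieldLift_pushforward`, which yield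
`tensorInChart_gNaturalMetric` and `fieldInChart_iotaLift_add_completeLift`. -/

namespace GNat

set_option maxSynthPendingDepth 3

/-! ### Coordinate calculus on a normed space: Lie derivatives, lifts and their change of
coordinates. -/

section Calculus

open ContinuousLinearMap

variable {E : Type*} [NormedAddCommGroup E] [NormedSpace ℝ E]

/-- The Lie derivative `L_X B` of a field of bilinear forms on a normed space. -/
noncomputable def lieForm (X : E → E) (B : E → E →L[ℝ] E →L[ℝ] ℝ) (y : E) : E →L[ℝ] E →L[ℝ] ℝ :=
  fderiv ℝ B y (X y) + (B y).comp (fderiv ℝ X y) +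
    ((compL ℝ E E ℝ).flip (fderiv ℝ X y)).comp (B y)

theorem lieForm_apply (X : E → E) (B : E → E →L[ℝ] E →L[ℝ] ℝ) (y v w : E) :
    lieForm X B y v w = fderiv ℝ B y (X y) v w + B y (fderiv ℝ X y v) w
      + B y v (fderiv ℝ X y w) := rfl

/-- The endomorphism field `-B⁻¹ (L_X B)`. -/
noncomputable def raisedLieForm (X : E → E) (B : E → E →L[ℝ] E →L[ℝ] ℝ) (y : E) : E →L[ℝ] E :=
  -((B y).inverse.comp (lieForm X B y))

/-- The coordinate expression of the vector field `ιC + X^C`. -/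
noncomputable def fieldLift (X : E → E) (B : E → E →L[ℝ] E →L[ℝ] ℝ) (Y : E × E) : E × E :=
  (X Y.1, raisedLieForm X B Y.1 Y.2 + fderiv ℝ X Y.1 Y.2)

/-- The coordinate expression of `β θ ⊗ θ + α B^C`, where `θ = B(u, ·)` and `B^C` is the complete
lift of `B`. -/
noncomputable def metricLift (B : E → E →L[ℝ] E →L[ℝ] ℝ) (α β : ℝ) (Y V W : E × E) : ℝ :=
  β * (B Y.1 V.1 Y.2 * B Y.1 W.1 Y.2) +
    α * (fderiv ℝ B Y.1 Y.2 V.1 W.1 + B Y.1 V.1 W.2 + B Y.1 V.2 W.1)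

/-- `inverse` is zero on non-invertible maps, so invertibility is essential here. The algebraic
identities for `raisedLieForm` below all go through this lowered relation. -/
theorem apply_raisedLieForm {X : E → E} {B : E → E →L[ℝ] E →L[ℝ] ℝ} {y : E}
    (h : (B y).IsInvertible) (w : E) : B y (raisedLieForm X B y w) = -lieForm X B y w := by
  obtain ⟨e, he⟩ := h
  simp [raisedLieForm, ← he]

theorem fderiv_clm_apply₂ {F : Type*} [NormedAddCommGroup F] [NormedSpace ℝ F]
    {B : F → E →L[ℝ] E →L[ℝ] ℝ} {a b : F → E} {y : F}
    (hB : DifferentiableAt ℝ B y) (ha : DifferentiableAt ℝ a y) (hb : DifferentiableAt ℝ b y)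
    (u : F) :
    fderiv ℝ (fun z => B z (a z) (b z)) y u
      = fderiv ℝ B y u (a y) (b y) + B y (fderiv ℝ a y u) (b y) + B y (a y) (fderiv ℝ b y u) := by
  rw [fderiv_clm_apply (hB.clm_apply ha) hb]
  simp only [add_apply, coe_comp, Function.comp_apply, flip_apply, fderiv_clm_apply hB ha]
  ring

theorem fderiv_clm_apply_const {F G : Type*} [NormedAddCommGroup F] [NormedSpace ℝ F]
    [NormedAddCommGroup G] [NormedSpace ℝ G] {A : F → E →L[ℝ] G} {y : F}
    (hA : DifferentiableAt ℝ A y) (v : E) (u : F) :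
    fderiv ℝ (fun z => A z v) y u = fderiv ℝ A y u v := by
  rw [fderiv_clm_apply hA (differentiableAt_const v)]
  simp

theorem fderiv_clm_apply_const₂ {F : Type*} [NormedAddCommGroup F] [NormedSpace ℝ F]
    {B : F → E →L[ℝ] E →L[ℝ] ℝ} {y : F} (hB : DifferentiableAt ℝ B y) (v w : E) (u : F) :
    fderiv ℝ (fun z => B z v w) y u = fderiv ℝ B y u v w := by
  rw [fderiv_clm_apply_const (hB.clm_apply (differentiableAt_const v)),
    fderiv_clm_apply_const hB]

theorem fderiv_fderiv_symm {F : Type*} [NormedAddCommGroup F] [NormedSpace ℝ F] {φ : E → F} {y : E}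
    (hφ : ContDiffAt ℝ ∞ φ y) (v w : E) :
    fderiv ℝ (fderiv ℝ φ) y v w = fderiv ℝ (fderiv ℝ φ) y w v :=
  (hφ.isSymmSndFDerivAt (by simpa using WithTop.coe_le_coe.2 (le_top (a := (2 : ℕ∞))))) v w

theorem contDiffAt_fderiv {F : Type*} [NormedAddCommGroup F] [NormedSpace ℝ F] {φ : E → F}
    {y : E} (hφ : ContDiffAt ℝ ∞ φ y) : ContDiffAt ℝ ∞ (fderiv ℝ φ) y :=
  hφ.fderiv_right (m := ∞) (by simp)

theorem differentiableAt_fderiv {F : Type*} [NormedAddCommGroup F] [NormedSpace ℝ F] {φ : E → F}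
    {y : E} (hφ : ContDiffAt ℝ ∞ φ y) : DifferentiableAt ℝ (fderiv ℝ φ) y :=
  (contDiffAt_fderiv hφ).differentiableAt (by simp)

section ChangeOfCoordinates

variable {φ : E → E} {y : E} {B B' : E → E →L[ℝ] E →L[ℝ] ℝ} {X X' : E → E}

theorem fderiv_pullback (hφ : ContDiffAt ℝ ∞ φ y) (hB : DifferentiableAt ℝ B y)
    (hB' : DifferentiableAt ℝ B' (φ y))
    (h : ∀ᶠ z in nhds y, ∀ v w, B z v w = B' (φ z) (fderiv ℝ φ z v) (fderiv ℝ φ z w)) (u v w : E) :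
    fderiv ℝ B y u v w
      = fderiv ℝ B' (φ y) (fderiv ℝ φ y u) (fderiv ℝ φ y v) (fderiv ℝ φ y w)
        + B' (φ y) (fderiv ℝ (fderiv ℝ φ) y u v) (fderiv ℝ φ y w)
        + B' (φ y) (fderiv ℝ φ y v) (fderiv ℝ (fderiv ℝ φ) y u w) := by
  have hφd : DifferentiableAt ℝ φ y := hφ.differentiableAt (by simp)
  have hD := differentiableAt_fderiv hφ
  have e : (fun z => B z v w) =ᶠ[nhds y]
      fun z => B' (φ z) (fderiv ℝ φ z v) (fderiv ℝ φ z w) := h.mono fun z hz => hz v w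
  have hc : DifferentiableAt ℝ (fun z => B' (φ z)) y :=
    DifferentiableAt.comp (G := E →L[ℝ] E →L[ℝ] ℝ) y hB' hφd
  have e2 := fderiv_clm_apply₂ hc
    (hD.clm_apply (differentiableAt_const v)) (hD.clm_apply (differentiableAt_const w)) u
  have e3 : fderiv ℝ (fun z => B' (φ z)) y u = fderiv ℝ B' (φ y) (fderiv ℝ φ y u) :=
    DFunLike.congr_fun (fderiv_comp (G := E →L[ℝ] E →L[ℝ] ℝ) y hB' hφd) u
  rw [← fderiv_clm_apply_const₂ hB, e.fderiv_eq, e2, e3, fderiv_clm_apply_const hD,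
    fderiv_clm_apply_const hD]

theorem fderiv_pushforward (hφ : ContDiffAt ℝ ∞ φ y) (hX : DifferentiableAt ℝ X y)
    (hX' : DifferentiableAt ℝ X' (φ y))
    (h : ∀ᶠ z in nhds y, X' (φ z) = fderiv ℝ φ z (X z)) (v : E) :
    fderiv ℝ X' (φ y) (fderiv ℝ φ y v)
      = fderiv ℝ (fderiv ℝ φ) y v (X y) + fderiv ℝ φ y (fderiv ℝ X y v) := by
  have hφd : DifferentiableAt ℝ φ y := hφ.differentiableAt (by simp)
  have e1 := DFunLike.congr_fun (Filter.EventuallyEq.fderiv_eq (𝕜 := ℝ) h) v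
  rw [fderiv_clm_apply (differentiableAt_fderiv hφ) hX,
    show (fun z => X' (φ z)) = X' ∘ φ from rfl, fderiv_comp y hX' hφd] at e1
  simp only [coe_comp, Function.comp_apply, add_apply, flip_apply] at e1
  rw [e1, add_comm]

/-- Naturality of the Lie derivative. The Hessian of `φ` enters once through the derivative of the
pulled back form and once through that of the pushed forward field; the two contributions agree
because the Hessian is symmetric. -/
theorem lieForm_pullback (hφ : ContDiffAt ℝ ∞ φ y) (hB : DifferentiableAt ℝ B y)
    (hB' : DifferentiableAt ℝ B' (φ y)) (hX : DifferentiableAt ℝ X y)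
    (hX' : DifferentiableAt ℝ X' (φ y))
    (h : ∀ᶠ z in nhds y, ∀ v w, B z v w = B' (φ z) (fderiv ℝ φ z v) (fderiv ℝ φ z w))
    (hXX : ∀ᶠ z in nhds y, X' (φ z) = fderiv ℝ φ z (X z)) (v w : E) :
    lieForm X' B' (φ y) (fderiv ℝ φ y v) (fderiv ℝ φ y w) = lieForm X B y v w := by
  rw [lieForm_apply, lieForm_apply, fderiv_pushforward hφ hX hX' hXX,
    fderiv_pushforward hφ hX hX' hXX, fderiv_pullback hφ hB hB' h, hXX.self_of_nhds,
    h.self_of_nhds, h.self_of_nhds, fderiv_fderiv_symm hφ v, fderiv_fderiv_symm hφ w]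
  simp only [map_add, add_apply]
  ring

theorem raisedLieForm_pushforward (hφ : ContDiffAt ℝ ∞ φ y) (hB : DifferentiableAt ℝ B y)
    (hB' : DifferentiableAt ℝ B' (φ y)) (hX : DifferentiableAt ℝ X y)
    (hX' : DifferentiableAt ℝ X' (φ y))
    (h : ∀ᶠ z in nhds y, ∀ v w, B z v w = B' (φ z) (fderiv ℝ φ z v) (fderiv ℝ φ z w))
    (hXX : ∀ᶠ z in nhds y, X' (φ z) = fderiv ℝ φ z (X z))
    (hi : (B y).IsInvertible) (hi' : (B' (φ y)).IsInvertible)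
    (hs : Function.Surjective (fderiv ℝ φ y)) (w : E) :
    raisedLieForm X' B' (φ y) (fderiv ℝ φ y w) = fderiv ℝ φ y (raisedLieForm X B y w) := by
  -- Vectors are compared by lowering them with `B'`; surjectivity of the derivative allows testing
  -- only on vectors `fderiv ℝ φ y z`.
  apply hi'.injective
  ext z
  obtain ⟨z, rfl⟩ := hs z
  rw [apply_raisedLieForm hi', ← h.self_of_nhds, apply_raisedLieForm hi, neg_apply, neg_apply,
    lieForm_pullback hφ hB hB' hX hX' h hXX]

/-- The pairs inserted on the left are the images of `V` and `W` under the differential of `(y, u) ↦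
(φ y, fderiv ℝ φ y u)`. Their Hessian parts are exactly what the non-tensorial term `fderiv ℝ B y u`
produces. -/
theorem metricLift_pullback (hφ : ContDiffAt ℝ ∞ φ y) (hB : DifferentiableAt ℝ B y)
    (hB' : DifferentiableAt ℝ B' (φ y))
    (h : ∀ᶠ z in nhds y, ∀ v w, B z v w = B' (φ z) (fderiv ℝ φ z v) (fderiv ℝ φ z w))
    (α β : ℝ) (u : E) (V W : E × E) :
    metricLift B' α β (φ y, fderiv ℝ φ y u)
        (fderiv ℝ φ y V.1, fderiv ℝ (fderiv ℝ φ) y V.1 u + fderiv ℝ φ y V.2)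
        (fderiv ℝ φ y W.1, fderiv ℝ (fderiv ℝ φ) y W.1 u + fderiv ℝ φ y W.2)
      = metricLift B α β (y, u) V W := by
  simp only [metricLift]
  rw [fderiv_pullback hφ hB hB' h, h.self_of_nhds, h.self_of_nhds, h.self_of_nhds,
    h.self_of_nhds, fderiv_fderiv_symm hφ V.1, fderiv_fderiv_symm hφ W.1]
  simp only [map_add, add_apply]
  ring

/-- The `raisedLieForm` part is tensorial, so the Hessian term comes from the complete lift alone.
-/
theorem fieldLift_pushforward (hφ : ContDiffAt ℝ ∞ φ y) (hB : DifferentiableAt ℝ B y)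
    (hB' : DifferentiableAt ℝ B' (φ y)) (hX : DifferentiableAt ℝ X y)
    (hX' : DifferentiableAt ℝ X' (φ y))
    (h : ∀ᶠ z in nhds y, ∀ v w, B z v w = B' (φ z) (fderiv ℝ φ z v) (fderiv ℝ φ z w))
    (hXX : ∀ᶠ z in nhds y, X' (φ z) = fderiv ℝ φ z (X z))
    (hi : (B y).IsInvertible) (hi' : (B' (φ y)).IsInvertible)
    (hs : Function.Surjective (fderiv ℝ φ y)) (u : E) :
    fieldLift X' B' (φ y, fderiv ℝ φ y u)
      = (fderiv ℝ φ y (fieldLift X B (y, u)).1,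
          fderiv ℝ (fderiv ℝ φ) y (fieldLift X B (y, u)).1 u
            + fderiv ℝ φ y (fieldLift X B (y, u)).2) := by
  simp only [fieldLift]
  rw [raisedLieForm_pushforward hφ hB hB' hX hX' h hXX hi hi' hs,
    fderiv_pushforward hφ hX hX' hXX, hXX.self_of_nhds, fderiv_fderiv_symm hφ u, map_add]
  congr 1
  abel

end ChangeOfCoordinates

section Smoothness

variable {B : E → E →L[ℝ] E →L[ℝ] ℝ} {X : E → E} {y : E}

theorem contDiffAt_lieForm (hB : ContDiffAt ℝ ∞ B y) (hX : ContDiffAt ℝ ∞ X y) :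
    ContDiffAt ℝ ∞ (lieForm X B) y := by
  have h2 := contDiffAt_fderiv hX
  have h3 : ContDiffAt ℝ ∞ (fun z => (compL ℝ E E ℝ).flip (fderiv ℝ X z)) y :=
    ContDiffAt.comp (G := (E →L[ℝ] ℝ) →L[ℝ] E →L[ℝ] ℝ) y
      (ContinuousLinearMap.contDiff (𝕜 := ℝ) (E := E →L[ℝ] E) (F := (E →L[ℝ] ℝ) →L[ℝ] E →L[ℝ] ℝ)
        (compL ℝ E E ℝ).flip).contDiffAt h2
  exact (((contDiffAt_fderiv hB).clm_apply hX).add (hB.clm_comp h2)).add (h3.clm_comp hB)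

theorem contDiffAt_raisedLieForm [CompleteSpace E] (hB : ContDiffAt ℝ ∞ B y)
    (hX : ContDiffAt ℝ ∞ X y) (hi : (B y).IsInvertible) :
    ContDiffAt ℝ ∞ (raisedLieForm X B) y :=
  ((hi.contDiffAt_map_inverse.comp y hB).clm_comp (contDiffAt_lieForm hB hX)).neg

theorem contDiffAt_fieldLift [CompleteSpace E] {u : E} (hB : ContDiffAt ℝ ∞ B y)
    (hX : ContDiffAt ℝ ∞ X y) (hi : (B y).IsInvertible) :
    ContDiffAt ℝ ∞ (fieldLift X B) (y, u) := by
  have hf : ContDiffAt ℝ ∞ (Prod.fst : E × E → E) (y, u) := contDiffAt_fst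
  exact (hX.comp (y, u) hf).prodMk
    ((((contDiffAt_raisedLieForm hB hX hi).comp (y, u) hf).clm_apply contDiffAt_snd).add
      (((contDiffAt_fderiv hX).comp (y, u) hf).clm_apply contDiffAt_snd))

end Smoothness

end Calculus

/-! ### The Killing identity in a single chart. -/

section KillingIdentity

open ContinuousLinearMap

variable {E : Type*} [NormedAddCommGroup E] [NormedSpace ℝ E]

/-- The Christoffel symbols of the first kind, without the factor `1 / 2`. -/
noncomputable def koszulForm (B : E → E →L[ℝ] E →L[ℝ] ℝ) (y v w : E) : E →L[ℝ] ℝ :=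
  fderiv ℝ B y v w + fderiv ℝ B y w v - ((fderiv ℝ B y).flip v).flip w

theorem koszulForm_apply (B : E → E →L[ℝ] E →L[ℝ] ℝ) (y v w z : E) :
    koszulForm B y v w z = fderiv ℝ B y v w z + fderiv ℝ B y w v z - fderiv ℝ B y z v w := rfl

/-- The Christoffel symbols of the second kind, as a bilinear map. -/
noncomputable def christoffelMap (B : E → E →L[ℝ] E →L[ℝ] ℝ) (y v w : E) : E :=
  (1 / 2 : ℝ) • (B y).inverse (koszulForm B y v w)

/-- The Lie derivative of the Christoffel symbols along `X`. -/
noncomputable def lieChristoffelMap (X : E → E) (B : E → E →L[ℝ] E →L[ℝ] ℝ) (y v w : E) : E :=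
  fderiv ℝ (fun z => christoffelMap B z v w) y (X y) + fderiv ℝ (fderiv ℝ X) y v w
    - fderiv ℝ X y (christoffelMap B y v w) + christoffelMap B y (fderiv ℝ X y v) w
    + christoffelMap B y v (fderiv ℝ X y w)

variable {B : E → E →L[ℝ] E →L[ℝ] ℝ} {X : E → E} {y : E}

theorem apply_christoffelMap (hi : (B y).IsInvertible) (v w : E) :
    B y (christoffelMap B y v w) = (1 / 2 : ℝ) • koszulForm B y v w := by
  obtain ⟨e, he⟩ := hi
  simp [christoffelMap, ← he]

theorem eventually_isInvertible [CompleteSpace E] (hB : ContinuousAt B y)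
    (hi : (B y).IsInvertible) : ∀ᶠ z in nhds y, (B z).IsInvertible := by
  obtain ⟨e, he⟩ := hi
  exact hB.eventually (he ▸ e.nhds)

theorem contDiffAt_koszulForm (hB : ContDiffAt ℝ ∞ B y) (v w : E) :
    ContDiffAt ℝ ∞ (fun z => koszulForm B z v w) y := by
  have h := contDiffAt_fderiv hB
  have h1 (a b : E) : ContDiffAt ℝ ∞ (fun z => fderiv ℝ B z a b) y :=
    (h.clm_apply contDiffAt_const).clm_apply contDiffAt_const
  have h2 : ContDiffAt ℝ ∞ (fun z => (fderiv ℝ B z).flip) y :=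
    ContDiffAt.comp (G := E →L[ℝ] E →L[ℝ] E →L[ℝ] ℝ) y
      (flipₗᵢ ℝ E E (E →L[ℝ] ℝ)).contDiff.contDiffAt h
  have h3 : ContDiffAt ℝ ∞ (fun z => (fderiv ℝ B z).flip v) y := h2.clm_apply contDiffAt_const
  have h4 : ContDiffAt ℝ ∞ (fun z => ((fderiv ℝ B z).flip v).flip) y :=
    ContDiffAt.comp (G := E →L[ℝ] E →L[ℝ] ℝ) y
      (flipₗᵢ ℝ E E ℝ).contDiff.contDiffAt h3
  exact ((h1 v w).add (h1 w v)).sub (h4.clm_apply contDiffAt_const)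

theorem contDiffAt_christoffelMap [CompleteSpace E] (hB : ContDiffAt ℝ ∞ B y)
    (hi : (B y).IsInvertible) (v w : E) :
    ContDiffAt ℝ ∞ (fun z => christoffelMap B z v w) y :=
  ((hi.contDiffAt_map_inverse.comp y hB).clm_apply (contDiffAt_koszulForm hB v w)).const_smul _

theorem fderiv_symm_of_symm (hB : DifferentiableAt ℝ B y)
    (hs : ∀ᶠ z in nhds y, ∀ v w, B z v w = B z w v) (u v w : E) :
    fderiv ℝ B y u v w = fderiv ℝ B y u w v := by
  have e : (fun z => B z v w) =ᶠ[nhds y] fun z => B z w v := hs.mono fun z hz => hz v w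
  rw [← fderiv_clm_apply_const₂ hB, e.fderiv_eq, fderiv_clm_apply_const₂ hB]

theorem lieForm_symm (hB : DifferentiableAt ℝ B y)
    (hs : ∀ᶠ z in nhds y, ∀ v w, B z v w = B z w v) (v w : E) :
    lieForm X B y v w = lieForm X B y w v := by
  rw [lieForm_apply, lieForm_apply, fderiv_symm_of_symm hB hs, hs.self_of_nhds v,
    hs.self_of_nhds _ w]
  ring

theorem fderiv_fderiv_clm_apply₂ (hB : ContDiffAt ℝ ∞ B y) {a : E → E} (ha : DifferentiableAt ℝ a y)
    (v w u : E) :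
    fderiv ℝ (fun z => fderiv ℝ B z (a z) v w) y u
      = fderiv ℝ (fderiv ℝ B) y u (a y) v w + fderiv ℝ B y (fderiv ℝ a y u) v w := by
  have hD := differentiableAt_fderiv hB
  rw [fderiv_clm_apply_const₂ (hD.clm_apply ha), fderiv_clm_apply hD ha]
  simp [add_comm]

theorem fderiv_lieForm (hB : ContDiffAt ℝ ∞ B y) (hX : ContDiffAt ℝ ∞ X y) (u v w : E) :
    fderiv ℝ (lieForm X B) y u v w
      = fderiv ℝ (fderiv ℝ B) y u (X y) v w + fderiv ℝ B y (fderiv ℝ X y u) v w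
        + fderiv ℝ B y u (fderiv ℝ X y v) w + B y (fderiv ℝ (fderiv ℝ X) y u v) w
        + fderiv ℝ B y u v (fderiv ℝ X y w) + B y v (fderiv ℝ (fderiv ℝ X) y u w) := by
  have hS : DifferentiableAt ℝ (lieForm X B) y :=
    (contDiffAt_lieForm hB hX).differentiableAt (by simp)
  have hBd : DifferentiableAt ℝ B y := hB.differentiableAt (by simp)
  have hXd : DifferentiableAt ℝ X y := hX.differentiableAt (by simp)
  have hD := differentiableAt_fderiv hB
  have hDX := differentiableAt_fderiv hX
  have hc (a : E) : DifferentiableAt ℝ (fun _ : E => a) y := differentiableAt_const a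
  have hv (a : E) : DifferentiableAt ℝ (fun z => fderiv ℝ X z a) y := hDX.clm_apply (hc a)
  have e : (fun z => lieForm X B z v w) = fun z => (fderiv ℝ B z (X z) v w
      + B z (fderiv ℝ X z v) w) + B z v (fderiv ℝ X z w) := rfl
  have d1 : DifferentiableAt ℝ (fun z => fderiv ℝ B z (X z) v w) y :=
    ((hD.clm_apply hXd).clm_apply (hc v)).clm_apply (hc w)
  have d2 : DifferentiableAt ℝ (fun z => B z (fderiv ℝ X z v) w) y :=
    (hBd.clm_apply (hv v)).clm_apply (hc w)
  have d3 : DifferentiableAt ℝ (fun z => B z v (fderiv ℝ X z w)) y :=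
    (hBd.clm_apply (hc v)).clm_apply (hv w)
  rw [← fderiv_clm_apply_const₂ hS, e, fderiv_fun_add (d1.fun_add d2) d3, fderiv_fun_add d1 d2,
    add_apply, add_apply, fderiv_fderiv_clm_apply₂ hB hXd, fderiv_clm_apply₂ hBd (hv v) (hc w),
    fderiv_clm_apply₂ hBd (hc v) (hv w), fderiv_clm_apply_const hDX, fderiv_clm_apply_const hDX]
  simp only [fderiv_fun_const, Pi.zero_apply, zero_apply, map_zero, add_zero]
  ring

theorem fderiv_lieForm_symm (hB : ContDiffAt ℝ ∞ B y) (hX : ContDiffAt ℝ ∞ X y)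
    (hs : ∀ᶠ z in nhds y, ∀ v w, B z v w = B z w v) (u v w : E) :
    fderiv ℝ (lieForm X B) y u v w = fderiv ℝ (lieForm X B) y u w v := by
  refine fderiv_symm_of_symm ((contDiffAt_lieForm hB hX).differentiableAt (by simp)) ?_ u v w
  -- The symmetry of `lieForm` is needed at all points near `y`. Only a finite order of
  -- differentiability spreads from a point to a neighbourhood, and order one suffices.
  have h1 : ContDiffAt ℝ 1 B y := hB.of_le (by exact_mod_cast le_top)
  filter_upwards [hs.eventually_nhds, h1.eventually (by simp)] with z hz hd v w
  exact lieForm_symm (hd.differentiableAt (by simp)) hz v w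

/-- `L_X Γ = 0` expressed through the covariant derivatives of `L_X B`. -/
theorem fderiv_lieForm_of_lieChristoffelMap_eq_zero [CompleteSpace E] (hB : ContDiffAt ℝ ∞ B y)
    (hX : ContDiffAt ℝ ∞ X y) (hi : (B y).IsInvertible)
    (hs : ∀ᶠ z in nhds y, ∀ v w, B z v w = B z w v) {v w : E}
    (hA : lieChristoffelMap X B y v w = 0) (t : E) :
    fderiv ℝ (lieForm X B) y v w t + fderiv ℝ (lieForm X B) y w v t
        - fderiv ℝ (lieForm X B) y t v w
      = 2 * lieForm X B y (christoffelMap B y v w) t := by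
  have hBd : DifferentiableAt ℝ B y := hB.differentiableAt (by simp)
  have hD := differentiableAt_fderiv hB
  have hΓ : DifferentiableAt ℝ (fun z => christoffelMap B z v w) y :=
    (contDiffAt_christoffelMap hB hi v w).differentiableAt (by simp)
  have hc (a : E) : DifferentiableAt ℝ (fun _ : E => a) y := differentiableAt_const a
  have d (a b c : E) : DifferentiableAt ℝ (fun z => fderiv ℝ B z a b c) y :=
    ((hD.clm_apply (hc a)).clm_apply (hc b)).clm_apply (hc c)
  have d' (a b c : E) : fderiv ℝ (fun z => fderiv ℝ B z a b c) y (X y)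
      = fderiv ℝ (fderiv ℝ B) y (X y) a b c := by
    rw [fderiv_fderiv_clm_apply₂ hB (hc a)]
    simp
  -- Differentiating the lowered symbols along `X` gives the derivative of the Christoffel map
  -- paired with `t`, without differentiating the inverse metric.
  have e : (fun z => B z (christoffelMap B z v w) t) =ᶠ[nhds y] fun z =>
      (1 / 2 : ℝ) * (fderiv ℝ B z v w t + fderiv ℝ B z w v t - fderiv ℝ B z t v w) := by
    filter_upwards [eventually_isInvertible hBd.continuousAt hi] with z hz
    rw [apply_christoffelMap hz]
    rfl
  have e1 := fderiv_clm_apply₂ hBd hΓ (hc t) (X y)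
  rw [e.fderiv_eq, fderiv_const_mul (((d v w t).fun_add (d w v t)).fun_sub (d t v w)),
    fderiv_fun_sub ((d v w t).fun_add (d w v t)) (d t v w), fderiv_fun_add (d v w t) (d w v t)]
    at e1
  simp only [smul_apply, sub_apply, add_apply, d', fderiv_fun_const, Pi.zero_apply, zero_apply,
    map_zero, add_zero, smul_eq_mul] at e1
  have k (a b c : E) : B y (christoffelMap B y a b) c = (1 / 2 : ℝ) *
      (fderiv ℝ B y a b c + fderiv ℝ B y b a c - fderiv ℝ B y c a b) := by
    rw [apply_christoffelMap hi]
    rfl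
  have hA' := DFunLike.congr_fun (congrArg (B y) hA) t
  simp only [lieChristoffelMap, map_add, map_sub, add_apply, sub_apply, k, map_zero,
    zero_apply] at hA'
  have sB := hs.self_of_nhds
  have sD := fderiv_symm_of_symm hBd hs
  have s2 (a b c d : E) : fderiv ℝ (fderiv ℝ B) y a b c d = fderiv ℝ (fderiv ℝ B) y b a c d := by
    rw [fderiv_fderiv_symm hB]
  have sX := fderiv_fderiv_symm hX
  -- After unfolding the right-hand side everything is linear: `e1` and `hA'` eliminate the
  -- derivative of the Christoffel map, `kt` removes the term with `fderiv ℝ X y t`, and the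
  -- symmetries align the rest.
  have kt := k v w (fderiv ℝ X y t)
  rw [fderiv_lieForm hB hX, fderiv_lieForm hB hX, fderiv_lieForm hB hX, lieForm_apply, kt,
    s2 v, s2 w, s2 t, sX w v, sX t v, sX t w, sB w, sB v, sB (fderiv ℝ (fderiv ℝ X) y v t) w]
  rw [sD v w, sD w v, sD _ v w] at *
  linarith

/-- Product rule applied to the relation $B(Cu,w)=-S(u,w)$, which holds on a neighbourhood because
invertibility is an open condition. -/
theorem fderiv_raisedLieForm [CompleteSpace E] (hB : ContDiffAt ℝ ∞ B y) (hX : ContDiffAt ℝ ∞ X y)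
    (hi : (B y).IsInvertible) (v u w : E) :
    B y (fderiv ℝ (raisedLieForm X B) y v u) w
      = -fderiv ℝ (lieForm X B) y v u w - fderiv ℝ B y v (raisedLieForm X B y u) w := by
  have hBd : DifferentiableAt ℝ B y := hB.differentiableAt (by simp)
  have hS : DifferentiableAt ℝ (lieForm X B) y :=
    (contDiffAt_lieForm hB hX).differentiableAt (by simp)
  have hP : DifferentiableAt ℝ (raisedLieForm X B) y :=
    (contDiffAt_raisedLieForm hB hX hi).differentiableAt (by simp)
  have hc (a : E) : DifferentiableAt ℝ (fun _ : E => a) y := differentiableAt_const a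
  have e : (fun z => B z (raisedLieForm X B z u) w) =ᶠ[nhds y] fun z => -lieForm X B z u w := by
    filter_upwards [eventually_isInvertible hBd.continuousAt hi] with z hz
    rw [apply_raisedLieForm hz]
    rfl
  have e1 := fderiv_clm_apply₂ hBd (hP.clm_apply (hc u)) (hc w) v
  rw [e.fderiv_eq, fderiv_fun_neg, neg_apply, fderiv_clm_apply_const₂ hS,
    fderiv_clm_apply_const hP] at e1
  simp only [fderiv_fun_const, Pi.zero_apply, zero_apply, map_zero, add_zero] at e1
  linarith

theorem fderiv_comp_fst {F : Type*} [NormedAddCommGroup F] [NormedSpace ℝ F] {f : E → F} {u : E}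
    (hf : DifferentiableAt ℝ f y) (V : E × E) :
    fderiv ℝ (fun Y : E × E => f Y.1) (y, u) V = fderiv ℝ f y V.1 := by
  have h : HasFDerivAt (fun Y : E × E => f Y.1) ((fderiv ℝ f y).comp (fst ℝ E E)) (y, u) :=
    HasFDerivAt.comp (y, u) (g := f) (f := Prod.fst) hf.hasFDerivAt hasFDerivAt_fst
  rw [h.fderiv]
  rfl

theorem fderiv_fieldLift [CompleteSpace E] (hB : ContDiffAt ℝ ∞ B y) (hX : ContDiffAt ℝ ∞ X y)
    (hi : (B y).IsInvertible) (u : E) (V : E × E) :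
    fderiv ℝ (fieldLift X B) (y, u) V
      = (fderiv ℝ X y V.1, fderiv ℝ (raisedLieForm X B) y V.1 u + raisedLieForm X B y V.2
          + (fderiv ℝ (fderiv ℝ X) y V.1 u + fderiv ℝ X y V.2)) := by
  have hXd : DifferentiableAt ℝ X y := hX.differentiableAt (by simp)
  have hP : DifferentiableAt ℝ (raisedLieForm X B) y :=
    (contDiffAt_raisedLieForm hB hX hi).differentiableAt (by simp)
  have hDX := differentiableAt_fderiv hX
  have hf : DifferentiableAt ℝ (Prod.fst : E × E → E) (y, u) := differentiableAt_fst
  have key {A : E → E →L[ℝ] E} (hA : DifferentiableAt ℝ A y) :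
      DifferentiableAt ℝ (fun Y : E × E => A Y.1 Y.2) (y, u) ∧
      fderiv ℝ (fun Y : E × E => A Y.1 Y.2) (y, u) V = fderiv ℝ A y V.1 u + A y V.2 := by
    have hA1 : DifferentiableAt ℝ (fun Y : E × E => A Y.1) (y, u) :=
      DifferentiableAt.comp (y, u) (g := A) (f := Prod.fst) hA hf
    refine ⟨hA1.clm_apply differentiableAt_snd, ?_⟩
    rw [fderiv_clm_apply hA1 differentiableAt_snd]
    simp [fderiv_comp_fst hA, fderiv_snd, add_comm]
  have h1 : DifferentiableAt ℝ (fun Y : E × E => X Y.1) (y, u) :=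
    DifferentiableAt.comp (y, u) (g := X) (f := Prod.fst) hXd hf
  change fderiv ℝ (fun Y : E × E => (X Y.1, raisedLieForm X B Y.1 Y.2 + fderiv ℝ X Y.1 Y.2))
    (y, u) V = _
  rw [DifferentiableAt.fderiv_prodMk h1 ((key hP).1.fun_add (key hDX).1),
    fderiv_fun_add (key hP).1 (key hDX).1]
  simp only [prod_apply, add_apply, (key hP).2, (key hDX).2, fderiv_comp_fst hXd]

set_option synthInstance.maxHeartbeats 200000 in
theorem fderiv_metricLift (hB : ContDiffAt ℝ ∞ B y) (α β : ℝ) (u : E) (V W A : E × E) :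
    fderiv ℝ (fun Y => metricLift B α β Y V W) (y, u) A
      = β * ((fderiv ℝ B y A.1 V.1 u + B y V.1 A.2) * B y W.1 u
          + B y V.1 u * (fderiv ℝ B y A.1 W.1 u + B y W.1 A.2))
        + α * (fderiv ℝ (fderiv ℝ B) y A.1 u V.1 W.1 + fderiv ℝ B y A.2 V.1 W.1
          + fderiv ℝ B y A.1 V.1 W.2 + fderiv ℝ B y A.1 V.2 W.1) := by
  have hBd : DifferentiableAt ℝ B y := hB.differentiableAt (by simp)
  have hD := differentiableAt_fderiv hB
  have hc (a : E) : DifferentiableAt ℝ (fun _ : E × E => a) (y, u) := differentiableAt_const a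
  have hf : DifferentiableAt ℝ (Prod.fst : E × E → E) (y, u) := differentiableAt_fst
  have hsn : DifferentiableAt ℝ (Prod.snd : E × E → E) (y, u) := differentiableAt_snd
  have hB1 : DifferentiableAt ℝ (fun Y : E × E => B Y.1) (y, u) :=
    DifferentiableAt.comp (y, u) (g := B) (f := Prod.fst) (G := E →L[ℝ] E →L[ℝ] ℝ) hBd hf
  have hD1 : DifferentiableAt ℝ (fun Y : E × E => fderiv ℝ B Y.1) (y, u) :=
    DifferentiableAt.comp (y, u) (g := fderiv ℝ B) (f := Prod.fst)
      (G := E →L[ℝ] E →L[ℝ] E →L[ℝ] ℝ) hD hf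
  have hDu := hD1.clm_apply hsn
  have t1 (a : E) : DifferentiableAt ℝ (fun Y : E × E => B Y.1 a Y.2) (y, u) :=
    (hB1.clm_apply (hc a)).clm_apply hsn
  have t2 (a b : E) : DifferentiableAt ℝ (fun Y : E × E => B Y.1 a b) (y, u) :=
    (hB1.clm_apply (hc a)).clm_apply (hc b)
  have t3 (a b : E) : DifferentiableAt ℝ (fun Y : E × E => fderiv ℝ B Y.1 Y.2 a b) (y, u) :=
    (hDu.clm_apply (hc a)).clm_apply (hc b)
  have r1 (a : E) : fderiv ℝ (fun Y : E × E => B Y.1 a Y.2) (y, u) A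
      = fderiv ℝ B y A.1 a u + B y a A.2 := by
    rw [fderiv_clm_apply₂ hB1 (hc a) hsn, fderiv_comp_fst hBd]
    simp [fderiv_snd]
  have r2 (a b : E) : fderiv ℝ (fun Y : E × E => B Y.1 a b) (y, u) A = fderiv ℝ B y A.1 a b := by
    rw [fderiv_clm_apply_const₂ hB1, fderiv_comp_fst hBd]
  have r3 (a b : E) : fderiv ℝ (fun Y : E × E => fderiv ℝ B Y.1 Y.2 a b) (y, u) A
      = fderiv ℝ (fderiv ℝ B) y A.1 u a b + fderiv ℝ B y A.2 a b := by
    rw [fderiv_clm_apply_const₂ hDu, fderiv_clm_apply hD1 hsn]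
    simp [fderiv_comp_fst hD, fderiv_snd, add_comm]
  simp only [metricLift]
  rw [fderiv_fun_add (((t1 _).fun_mul (t1 _)).const_mul β)
      ((((t3 _ _).fun_add (t2 _ _)).fun_add (t2 _ _)).const_mul α),
    fderiv_const_mul ((t1 _).fun_mul (t1 _)),
    fderiv_const_mul (((t3 _ _).fun_add (t2 _ _)).fun_add (t2 _ _)),
    fderiv_fun_mul (t1 _) (t1 _), fderiv_fun_add ((t3 _ _).fun_add (t2 _ _)) (t2 _ _),
    fderiv_fun_add (t3 _ _) (t2 _ _)]
  simp only [add_apply, smul_apply, smul_eq_mul, r1, r2, r3]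
  ring

/-- The `β` terms cancel because $\theta$ is invariant under the lifted field. In the `α` terms
everything cancels except the combination of derivatives of $S$ controlled by $L_X\Gamma=0$, with
`u` in the third slot. -/
theorem lieDeriv_metricLift_eq_zero [CompleteSpace E] (hB : ContDiffAt ℝ ∞ B y)
    (hX : ContDiffAt ℝ ∞ X y) (hi : (B y).IsInvertible)
    (hs : ∀ᶠ z in nhds y, ∀ v w, B z v w = B z w v)
    (hA : ∀ v w, lieChristoffelMap X B y v w = 0) (α β : ℝ) (u : E) (V W : E × E) :
    fderiv ℝ (fun Y => metricLift B α β Y V W) (y, u) (fieldLift X B (y, u))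
      + metricLift B α β (y, u) (fderiv ℝ (fieldLift X B) (y, u) V) W
      + metricLift B α β (y, u) V (fderiv ℝ (fieldLift X B) (y, u) W) = 0 := by
  have hBd : DifferentiableAt ℝ B y := hB.differentiableAt (by simp)
  have sB := hs.self_of_nhds
  have sD := fderiv_symm_of_symm hBd hs
  have sS := lieForm_symm (X := X) hBd hs
  have hP (a b : E) : B y (raisedLieForm X B y a) b = -lieForm X B y a b := by
    rw [apply_raisedLieForm hi]
    rfl
  have hP' (a b : E) : B y b (raisedLieForm X B y a) = -lieForm X B y a b := by
    rw [sB, hP]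
  have hDP := fderiv_raisedLieForm hB hX hi
  have hDP' (v u w : E) : B y w (fderiv ℝ (raisedLieForm X B) y v u)
      = -fderiv ℝ (lieForm X B) y v u w - fderiv ℝ B y v (raisedLieForm X B y u) w := by
    rw [sB, hDP]
  -- The term $2S(\Gamma(V_1,W_1),u)$ equals $-2B(\Gamma(V_1,W_1),Cu)$, hence is minus the Koszul
  -- form at $Cu$. These derivatives of `B` are the ones produced by differentiating $C$ and by
  -- moving along $Cu$.
  have hΓ : B y (christoffelMap B y V.1 W.1) (raisedLieForm X B y u) = (1 / 2 : ℝ) *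
      (fderiv ℝ B y V.1 W.1 (raisedLieForm X B y u) + fderiv ℝ B y W.1 V.1 (raisedLieForm X B y u)
        - fderiv ℝ B y (raisedLieForm X B y u) V.1 W.1) := by
    rw [apply_christoffelMap hi]
    rfl
  have key := fderiv_lieForm_of_lieChristoffelMap_eq_zero hB hX hi hs (hA V.1 W.1) u
  rw [sS, ← neg_eq_iff_eq_neg.2 (hP' u _), hΓ, fderiv_lieForm_symm hB hX hs V.1,
    fderiv_lieForm_symm hB hX hs W.1, fderiv_lieForm hB hX u, fderiv_fderiv_symm hB u] at key
  have l1 := lieForm_apply X B y u V.1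
  have l2 := lieForm_apply X B y u W.1
  rw [fderiv_metricLift hB, fderiv_fieldLift hB hX hi, fderiv_fieldLift hB hX hi]
  simp only [metricLift, fieldLift, map_add, add_apply, hP, hP', hDP, hDP']
  rw [sS W.2, lieForm_apply X B y V.2, lieForm_apply X B y V.1, l1, l2,
    sD (X y) u V.1, sD (X y) u W.1, sB (fderiv ℝ X y u) V.1, sB (fderiv ℝ X y u) W.1,
    sB u (fderiv ℝ X y V.1), sB u (fderiv ℝ X y W.1), sD V.1 _ W.1, sD W.1 _ V.1]
  rw [fderiv_fderiv_symm hX u V.1, fderiv_fderiv_symm hX u W.1] at key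
  linear_combination -α * key

end KillingIdentity

/-! ### Tangent coordinates on a manifold and transitions between preferred charts. -/

section Charts

variable {F : Type*} [NormedAddCommGroup F] [NormedSpace ℝ F]
  {H : Type*} [TopologicalSpace H] {I : ModelWithCorners ℝ F H}
  {N : Type*} [TopologicalSpace N] [ChartedSpace H N]

theorem tangentCoordChange_eq_fderiv [I.Boundaryless] [IsManifold I 1 N] (p q r : N) :
    tangentCoordChange I p q r
      = fderiv ℝ (extChartAt I q ∘ (extChartAt I p).symm) (extChartAt I p r) := by
  rw [tangentCoordChange_def, I.range_eq_univ, fderivWithin_univ]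

/-- The tangent space at a point is identified with the model space by the point's own preferred
chart, so reading off a coordinate vector of the chart at `p` means differentiating a transition
into that chart. -/
theorem symmL_eq_fderiv [I.Boundaryless] [IsManifold I 1 N]
    {p : N} {y : F} (hy : y ∈ (extChartAt I p).target) :
    (trivializationAt F (TangentSpace I : N → Type _) p).symmL ℝ ((extChartAt I p).symm y)
      = fderiv ℝ (extChartAt I ((extChartAt I p).symm y) ∘ (extChartAt I p).symm) y := by
  have hq : (extChartAt I p).symm y ∈ (chartAt H p).source := by
    rw [← extChartAt_source I]
    exact (extChartAt I p).map_target hy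
  rw [TangentBundle.symmL_trivializationAt_eq_core hq]
  refine (tangentCoordChange_eq_fderiv _ _ _).trans ?_
  rw [(extChartAt I p).right_inv hy]

theorem symmL_fderiv_transition [I.Boundaryless] [IsManifold I 1 N]
    {p p' : N} {y : F} (hy : y ∈ (extChartAt I p).target)
    (hy' : (extChartAt I p).symm y ∈ (extChartAt I p').source) (v : F) :
    (trivializationAt F (TangentSpace I : N → Type _) p').symmL ℝ ((extChartAt I p).symm y)
        (fderiv ℝ (extChartAt I p' ∘ (extChartAt I p).symm) y v)
      = (trivializationAt F (TangentSpace I : N → Type _) p).symmL ℝ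
          ((extChartAt I p).symm y) v := by
  have hs := (extChartAt I p).map_target hy
  have e := TangentBundle.symmL_trivializationAt_eq_core (I := I) (b₀ := p)
    (b := (extChartAt I p).symm y) (by rwa [← extChartAt_source I])
  have e' := TangentBundle.symmL_trivializationAt_eq_core (I := I) (b₀ := p')
    (b := (extChartAt I p).symm y) (by rwa [← extChartAt_source I])
  refine (DFunLike.congr_fun e' _).trans (Eq.trans ?_ (DFunLike.congr_fun e _).symm)
  have h1 := tangentCoordChange_eq_fderiv (I := I) p p' ((extChartAt I p).symm y)
  rw [(extChartAt I p).right_inv hy] at h1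
  rw [← h1]
  exact tangentCoordChange_comp (E := F) ⟨⟨hs, hy'⟩, mem_extChartAt_source _⟩

theorem fieldInChart_transition [I.Boundaryless] [IsManifold I 1 N]
    (Z : ∀ q : N, TangentSpace I q) {p p' : N} {y : F}
    (hy : y ∈ (extChartAt I p).target)
    (hy' : (extChartAt I p).symm y ∈ (extChartAt I p').source) :
    fieldInChart I Z p' ((extChartAt I p' ∘ (extChartAt I p).symm) y)
      = fderiv ℝ (extChartAt I p' ∘ (extChartAt I p).symm) y (fieldInChart I Z p y) := by
  have hs := (extChartAt I p).map_target hy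
  have h1 := tangentCoordChange_eq_fderiv (I := I) p p' ((extChartAt I p).symm y)
  rw [(extChartAt I p).right_inv hy] at h1
  rw [fieldInChart, fieldInChart, Function.comp_apply, (extChartAt I p').left_inv hy',
    TangentBundle.continuousLinearMapAt_trivializationAt_eq_core (by rwa [← extChartAt_source I]),
    TangentBundle.continuousLinearMapAt_trivializationAt_eq_core (by rwa [← extChartAt_source I]),
    ← h1]
  exact (tangentCoordChange_comp ⟨⟨mem_extChartAt_source _, hs⟩, hy'⟩).symm

theorem fieldInChart_eq_of_symmL_eq [IsManifold I 1 N] {Z : ∀ q : N, TangentSpace I q} {p : N} {y v : F}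
    (hy : y ∈ (extChartAt I p).target)
    (h : (trivializationAt F (TangentSpace I : N → Type _) p).symmL ℝ ((extChartAt I p).symm y) v
      = Z ((extChartAt I p).symm y)) : fieldInChart I Z p y = v := by
  rw [fieldInChart, ← h]
  apply Trivialization.continuousLinearMapAt_symmL
  rw [TangentBundle.trivializationAt_baseSet, ← extChartAt_source I]
  exact (extChartAt I p).map_target hy

theorem symmL_self [IsManifold I 1 N] (p : N) (v : F) :
    (trivializationAt F (TangentSpace I : N → Type _) p).symmL ℝ p v = v := by
  have h := TangentBundle.symmL_trivializationAt_eq_core (I := I) (mem_chart_source H p)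
  exact (DFunLike.congr_fun h v).trans <| tangentCoordChange_self (E := F) (mem_extChartAt_source p)

theorem continuousLinearMapAt_self [IsManifold I 1 N] (p : N) (v : TangentSpace I p) :
    (trivializationAt F (TangentSpace I : N → Type _) p).continuousLinearMapAt ℝ p v = v := by
  rw [TangentBundle.continuousLinearMapAt_trivializationAt_eq_core (mem_chart_source H p)]
  exact tangentCoordChange_self (E := F) (mem_extChartAt_source p)

theorem fieldInChart_self [IsManifold I 1 N] (Z : ∀ q : N, TangentSpace I q) (p : N) :
    fieldInChart I Z p (extChartAt I p p) = Z p := by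
  rw [fieldInChart, extChartAt_to_inv]
  exact continuousLinearMapAt_self p _

theorem tensorInChart_self [IsManifold I 1 N] (T : ∀ q : N, TangentSpace I q → TangentSpace I q → ℝ) (p : N)
    (v w : F) : tensorInChart I T p (extChartAt I p p) v w = T p v w := by
  rw [tensorInChart, extChartAt_to_inv, symmL_self, symmL_self]

theorem contDiffAt_transition [I.Boundaryless] [IsManifold I ∞ N] {p p' : N} {y : F}
    (hy : y ∈ (extChartAt I p).target)
    (hy' : (extChartAt I p).symm y ∈ (extChartAt I p').source) :
    ContDiffAt ℝ ∞ (extChartAt I p' ∘ (extChartAt I p).symm) y := by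
  rw [← contDiffWithinAt_univ, ← I.range_eq_univ]
  exact contDiffWithinAt_ext_coord_change p' p (by
    rw [PartialEquiv.trans_source]
    exact ⟨hy, hy'⟩)

theorem eventually_mem_transition [I.Boundaryless] {p : N} {S : Set N} (hS : IsOpen S) {y : F}
    (hy : y ∈ (extChartAt I p).target) (hy' : (extChartAt I p).symm y ∈ S) :
    ∀ᶠ z in nhds y, z ∈ (extChartAt I p).target ∧ (extChartAt I p).symm z ∈ S :=
  ((isOpen_extChartAt_target p).mem_nhds hy |> Filter.eventually_mem_set.2).and
    ((continuousAt_extChartAt_symm'' hy).eventually (hS.mem_nhds hy'))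

/-- A vector field is smooth at a point iff its components in a chart are. -/
theorem contMDiffAt_iff_contDiffAt_fieldInChart [I.Boundaryless] [IsManifold I ∞ N]
    {Z : ∀ q : N, TangentSpace I q}
    {p : N} {y : F} (hy : y ∈ (extChartAt I p).target) :
    ContMDiffAt I I.tangent ∞ (fun q => (⟨q, Z q⟩ : TangentBundle I N)) ((extChartAt I p).symm y)
      ↔ ContDiffAt ℝ ∞ (fieldInChart I Z p) y := by
  have hs := (extChartAt I p).map_target hy
  have hb : (extChartAt I p).symm y
      ∈ (trivializationAt F (TangentSpace I : N → Type _) p).baseSet := by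
    rwa [TangentBundle.trivializationAt_baseSet, ← extChartAt_source I]
  refine (Trivialization.contMDiffAt_section_iff (IB := I) (n := ∞)
    (trivializationAt F (TangentSpace I : N → Type _) p) hb).trans ?_
  rw [contMDiffAt_iff_source_of_mem_source (x := p) (by rwa [← extChartAt_source I]),
    (extChartAt I p).right_inv hy, I.range_eq_univ, contMDiffWithinAt_univ,
    contMDiffAt_iff_contDiffAt]
  have e : (fun q => (trivializationAt F (TangentSpace I : N → Type _) p ⟨q, Z q⟩).2)
      ∘ (extChartAt I p).symm =ᶠ[nhds y] fieldInChart I Z p := by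
    filter_upwards [(isOpen_extChartAt_target (I := I) p).mem_nhds hy] with z hz
    rw [fieldInChart, Function.comp_apply, Trivialization.continuousLinearMapAt_apply,
      Trivialization.linearMapAt_apply, if_pos]
    rw [TangentBundle.trivializationAt_baseSet, ← extChartAt_source I]
    exact (extChartAt I p).map_target hz
  exact ⟨fun h => h.congr_of_eventuallyEq e.symm, fun h => h.congr_of_eventuallyEq e⟩

end Charts

/-! ### The Riemannian metric as a smooth field of invertible bilinear forms in a chart. -/

section LocalMetric

variable {n : ℕ} {M : Type*} [TopologicalSpace M] [ChartedSpace (EuclideanSpace ℝ (Fin n)) M]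
  [IsManifold (𝓡 n) ∞ M]
  (g : ContMDiffRiemannianMetric (𝓡 n) ∞ (EuclideanSpace ℝ (Fin n))
      (TangentSpace (𝓡 n) : M → Type _))

/-- The metric in the preferred chart at `x`, as a field of bilinear forms. -/
noncomputable def localMetric (x : M) (y : EuclideanSpace ℝ (Fin n)) :
    EuclideanSpace ℝ (Fin n) →L[ℝ] EuclideanSpace ℝ (Fin n) →L[ℝ] ℝ :=
  let L : EuclideanSpace ℝ (Fin n) →L[ℝ] EuclideanSpace ℝ (Fin n) :=
    (trivializationAt (EuclideanSpace ℝ (Fin n)) (TangentSpace (𝓡 n) : M → Type _) x).symmL ℝ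
      ((extChartAt (𝓡 n) x).symm y)
  let G : EuclideanSpace ℝ (Fin n) →L[ℝ] EuclideanSpace ℝ (Fin n) →L[ℝ] ℝ :=
    g.inner ((extChartAt (𝓡 n) x).symm y)
  G.bilinearComp L L

theorem localMetric_apply (x : M) (y v w : EuclideanSpace ℝ (Fin n)) :
    localMetric g x y v w = tensorInChart (𝓡 n) (fun q v w => g.inner q v w) x y v w := rfl

theorem localMetric_symm (x : M) (y v w : EuclideanSpace ℝ (Fin n)) :
    localMetric g x y v w = localMetric g x y w v := g.symm _ _ _

theorem localMetric_self (x : M) (v w : EuclideanSpace ℝ (Fin n)) :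
    localMetric g x (extChartAt (𝓡 n) x x) v w = g.inner x v w :=
  tensorInChart_self (fun q v w => g.inner q v w) x v w

theorem localMetric_pos (x : M) {y : EuclideanSpace ℝ (Fin n)}
    (hy : y ∈ (extChartAt (𝓡 n) x).target) {v : EuclideanSpace ℝ (Fin n)} (hv : v ≠ 0) :
    0 < localMetric g x y v v := by
  refine g.pos _ _ fun h => hv ?_
  have hb : (extChartAt (𝓡 n) x).symm y
      ∈ (trivializationAt (EuclideanSpace ℝ (Fin n)) (TangentSpace (𝓡 n) : M → Type _) x).baseSet := by
    rw [TangentBundle.trivializationAt_baseSet, ← extChartAt_source (𝓡 n)]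
    exact (extChartAt (𝓡 n) x).map_target hy
  have h1 := Trivialization.continuousLinearMapAt_symmL (R := ℝ) _ hb v
  exact h1.symm.trans ((congrArg _ h).trans (map_zero _))

/-- Positivity gives injectivity, and the dual has the same finite dimension. -/
theorem localMetric_isInvertible (x : M) {y : EuclideanSpace ℝ (Fin n)}
    (hy : y ∈ (extChartAt (𝓡 n) x).target) : (localMetric g x y).IsInvertible := by
  have hinj : Function.Injective (localMetric g x y : EuclideanSpace ℝ (Fin n) →ₗ[ℝ]
      EuclideanSpace ℝ (Fin n) →L[ℝ] ℝ) := by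
    rw [← LinearMap.ker_eq_bot, LinearMap.ker_eq_bot']
    intro v hv
    by_contra h
    have h1 := localMetric_pos g x hy h
    have h2 : localMetric g x y v = 0 := hv
    simp [h2] at h1
  have hd : Module.finrank ℝ (EuclideanSpace ℝ (Fin n))
      = Module.finrank ℝ (EuclideanSpace ℝ (Fin n) →L[ℝ] ℝ) := by
    rw [LinearEquiv.finrank_eq (LinearMap.toContinuousLinearMap (𝕜 := ℝ)
      (E := EuclideanSpace ℝ (Fin n)) (F' := ℝ)).symm, Subspace.dual_finrank_eq]
  refine ⟨(LinearEquiv.ofInjectiveOfFinrankEq _ hinj hd).toContinuousLinearEquiv, ?_⟩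
  ext v w
  rfl

theorem localMetric_transition {x x' : M} {y : EuclideanSpace ℝ (Fin n)}
    (hy : y ∈ (extChartAt (𝓡 n) x).target)
    (hy' : (extChartAt (𝓡 n) x).symm y ∈ (extChartAt (𝓡 n) x').source)
    (v w : EuclideanSpace ℝ (Fin n)) :
    localMetric g x y v w
      = localMetric g x' ((extChartAt (𝓡 n) x' ∘ (extChartAt (𝓡 n) x).symm) y)
        (fderiv ℝ (extChartAt (𝓡 n) x' ∘ (extChartAt (𝓡 n) x).symm) y v)
        (fderiv ℝ (extChartAt (𝓡 n) x' ∘ (extChartAt (𝓡 n) x).symm) y w) := by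
  rw [localMetric_apply, localMetric_apply, tensorInChart, tensorInChart, Function.comp_apply,
    (extChartAt (𝓡 n) x').left_inv hy', symmL_fderiv_transition hy hy',
    symmL_fderiv_transition hy hy']

/-- The smooth metric section is evaluated on two coordinate fields of the chart, which are smooth
since their components there are constant. -/
theorem contDiffAt_localMetric_apply (x : M) {y : EuclideanSpace ℝ (Fin n)}
    (hy : y ∈ (extChartAt (𝓡 n) x).target) (v w : EuclideanSpace ℝ (Fin n)) :
    ContDiffAt ℝ ∞ (fun z => localMetric g x z v w) y := by
  have hs := (extChartAt (𝓡 n) x).map_target hy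
  have hv (v : EuclideanSpace ℝ (Fin n)) : ContMDiffAt (𝓡 n) (𝓡 n).tangent ∞
      (fun q : M => (⟨q, (trivializationAt (EuclideanSpace ℝ (Fin n))
        (TangentSpace (𝓡 n) : M → Type _) x).symmL ℝ q v⟩ : TangentBundle (𝓡 n) M))
      ((extChartAt (𝓡 n) x).symm y) := by
    rw [contMDiffAt_iff_contDiffAt_fieldInChart hy]
    have e : fieldInChart (𝓡 n) (fun q : M => (trivializationAt (EuclideanSpace ℝ (Fin n))
        (TangentSpace (𝓡 n) : M → Type _) x).symmL ℝ q v) x =ᶠ[nhds y] fun _ => v := by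
      filter_upwards [(isOpen_extChartAt_target (I := 𝓡 n) x).mem_nhds hy] with z hz
      exact fieldInChart_eq_of_symmL_eq hz rfl
    exact contDiffAt_const.congr_of_eventuallyEq e
  have h1 : ContMDiffAt (𝓡 n) ((𝓡 n).prod 𝓘(ℝ)) ∞
      (fun q : M => TotalSpace.mk' ℝ (E := Bundle.Trivial M ℝ) q
        (g.inner q ((trivializationAt (EuclideanSpace ℝ (Fin n))
          (TangentSpace (𝓡 n) : M → Type _) x).symmL ℝ q v)
          ((trivializationAt (EuclideanSpace ℝ (Fin n))
          (TangentSpace (𝓡 n) : M → Type _) x).symmL ℝ q w)))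
      ((extChartAt (𝓡 n) x).symm y) := by
    apply ContMDiffAt.clm_bundle_apply₂ (F₁ := EuclideanSpace ℝ (Fin n))
      (F₂ := EuclideanSpace ℝ (Fin n))
    · exact g.contMDiff.contMDiffAt
    · exact hv v
    · exact hv w
  have h2 := (contMDiffAt_totalSpace.1 h1).2
  rw [contMDiffAt_iff_source_of_mem_source (x := x) (by rwa [← extChartAt_source (𝓡 n)]),
    (extChartAt (𝓡 n) x).right_inv hy, (𝓡 n).range_eq_univ, contMDiffWithinAt_univ,
    contMDiffAt_iff_contDiffAt] at h2
  exact h2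

/-- In finite dimension, smoothness of an operator-valued map can be tested on fixed vectors. -/
theorem contDiffAt_localMetric (x : M) {y : EuclideanSpace ℝ (Fin n)}
    (hy : y ∈ (extChartAt (𝓡 n) x).target) : ContDiffAt ℝ ∞ (localMetric g x) y := by
  have h : ContDiffOn ℝ ∞ (localMetric g x) (extChartAt (𝓡 n) x).target :=
    contDiffOn_clm_apply.2 fun v => contDiffOn_clm_apply.2 fun w z hz =>
      (contDiffAt_localMetric_apply g x hz v w).contDiffWithinAt
  exact (h y hy).contDiffAt ((isOpen_extChartAt_target (I := 𝓡 n) x).mem_nhds hy)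

end LocalMetric

/-! ### Translation between index formulas and coordinate-free expressions. -/

section Components

variable {n : ℕ}

theorem sum_coord_smul (v : EuclideanSpace ℝ (Fin n)) : ∑ i, v i • basisVec i = v := by
  ext j
  simp [basisVec, Pi.single_apply]

theorem ext_basisVec {G : Type*} [NormedAddCommGroup G] [NormedSpace ℝ G]
    {A A' : EuclideanSpace ℝ (Fin n) →L[ℝ] G} (h : ∀ i, A (basisVec i) = A' (basisVec i)) :
    A = A' := by
  ext v
  rw [← sum_coord_smul v]
  simp [map_sum, h]

variable {M : Type*} [TopologicalSpace M] [ChartedSpace (EuclideanSpace ℝ (Fin n)) M]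
  [IsManifold (𝓡 n) ∞ M]
  (g : ContMDiffRiemannianMetric (𝓡 n) ∞ (EuclideanSpace ℝ (Fin n))
      (TangentSpace (𝓡 n) : M → Type _))

theorem metricMatrix_apply (x : M) (y : EuclideanSpace ℝ (Fin n)) (i j : Fin n) :
    metricMatrix g x y i j = localMetric g x y (basisVec i) (basisVec j) := rfl

theorem localMetric_basisVec (x : M) (y v : EuclideanSpace ℝ (Fin n)) (m : Fin n) :
    localMetric g x y v (basisVec m) = (metricMatrix g x y).mulVec v m := by
  conv_lhs => rw [← sum_coord_smul v]
  simp only [map_sum, map_smul, sum_apply, smul_apply,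
    Matrix.mulVec, dotProduct, metricMatrix_apply, smul_eq_mul]
  refine Finset.sum_congr rfl fun i _ => ?_
  rw [localMetric_symm, mul_comm]

theorem isUnit_det_metricMatrix (x : M) {y : EuclideanSpace ℝ (Fin n)}
    (hy : y ∈ (extChartAt (𝓡 n) x).target) : IsUnit (metricMatrix g x y).det := by
  rw [← Matrix.isUnit_iff_isUnit_det, ← Matrix.mulVec_injective_iff_isUnit,
    ← Matrix.coe_mulVecLin, injective_iff_map_eq_zero]
  intro v hv
  by_contra h
  have hv' : WithLp.toLp 2 v ≠ 0 := by simpa using h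
  have h1 := localMetric_pos g x hy hv'
  have h2 : localMetric g x y (WithLp.toLp 2 v) = 0 :=
    ext_basisVec fun m => by
      rw [localMetric_basisVec]
      exact congrFun hv m
  simp [h2] at h1

/-- A vector given by contracting a covector with the inverse metric matrix. -/
theorem localMetric_inv_sum (x : M) {y : EuclideanSpace ℝ (Fin n)}
    (hy : y ∈ (extChartAt (𝓡 n) x).target) (c : Fin n → ℝ) (m : Fin n) :
    localMetric g x y (WithLp.toLp 2 fun k => ∑ l, (metricMatrix g x y)⁻¹ k l * c l) (basisVec m)
      = c m := by
  rw [localMetric_basisVec]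
  change ((metricMatrix g x y).mulVec ((metricMatrix g x y)⁻¹.mulVec c)) m = c m
  rw [Matrix.mulVec_mulVec, Matrix.mul_nonsing_inv _ (isUnit_det_metricMatrix g x hy),
    Matrix.one_mulVec]

/-- Raising an index: turns a lowered identity into the inverse-matrix sums used to define
`christoffel` and `tensorC`. -/
theorem eq_inv_sum (x : M) {y : EuclideanSpace ℝ (Fin n)}
    (hy : y ∈ (extChartAt (𝓡 n) x).target) {a : EuclideanSpace ℝ (Fin n)} {c : Fin n → ℝ}
    (h : ∀ m, localMetric g x y a (basisVec m) = c m) (k : Fin n) :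
    a k = ∑ l, (metricMatrix g x y)⁻¹ k l * c l := by
  have e : a = WithLp.toLp 2 fun k => ∑ l, (metricMatrix g x y)⁻¹ k l * c l :=
    (localMetric_isInvertible g x hy).injective <| ext_basisVec fun m => by
      rw [h, localMetric_inv_sum g x hy]
  exact congrArg (fun b : EuclideanSpace ℝ (Fin n) => b k) e

theorem pderiv_metricMatrix (x : M) {y : EuclideanSpace ℝ (Fin n)}
    (hy : y ∈ (extChartAt (𝓡 n) x).target) (l i j : Fin n) :
    pderiv l (fun z => metricMatrix g x z i j) y
      = fderiv ℝ (localMetric g x) y (basisVec l) (basisVec i) (basisVec j) :=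
  fderiv_clm_apply_const₂ ((contDiffAt_localMetric g x hy).differentiableAt (by simp)) _ _ _

theorem fderiv_localMetric_symm (x : M) {y : EuclideanSpace ℝ (Fin n)}
    (hy : y ∈ (extChartAt (𝓡 n) x).target) (u v w : EuclideanSpace ℝ (Fin n)) :
    fderiv ℝ (localMetric g x) y u v w = fderiv ℝ (localMetric g x) y u w v :=
  fderiv_symm_of_symm ((contDiffAt_localMetric g x hy).differentiableAt (by simp))
    (Filter.Eventually.of_forall fun z => localMetric_symm g x z) _ _ _

theorem christoffel_eq (x : M) {y : EuclideanSpace ℝ (Fin n)}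
    (hy : y ∈ (extChartAt (𝓡 n) x).target) (k i j : Fin n) :
    christoffel g x k i j y
      = christoffelMap (localMetric g x) y (basisVec i) (basisVec j) k := by
  have h (m : Fin n) : localMetric g x y
      (christoffelMap (localMetric g x) y (basisVec i) (basisVec j)) (basisVec m)
      = (1 / 2 : ℝ) * (pderiv i (fun z => metricMatrix g x z j m) y
        + pderiv j (fun z => metricMatrix g x z i m) y
        - pderiv m (fun z => metricMatrix g x z i j) y) := by
    rw [apply_christoffelMap (localMetric_isInvertible g x hy), pderiv_metricMatrix g x hy,
      pderiv_metricMatrix g x hy, pderiv_metricMatrix g x hy]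
    rfl
  rw [eq_inv_sum g x hy h, christoffel, Finset.mul_sum]
  exact Finset.sum_congr rfl fun l _ => by ring

theorem sum_coord_mul {m : ℕ} (A : EuclideanSpace ℝ (Fin n) → EuclideanSpace ℝ (Fin m))
    (hA : IsLinearMap ℝ A) (v : EuclideanSpace ℝ (Fin n)) (k : Fin m) :
    ∑ i, v i * A (basisVec i) k = A v k := by
  conv_rhs => rw [← sum_coord_smul v]
  change _ = (hA.mk' A) _ k
  simp only [map_sum, map_smul]
  simp

theorem sum_coord_mul_clm {m : ℕ} (A : EuclideanSpace ℝ (Fin n) →L[ℝ] EuclideanSpace ℝ (Fin m))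
    (v : EuclideanSpace ℝ (Fin n)) (k : Fin m) : ∑ i, v i * A (basisVec i) k = A v k :=
  sum_coord_mul A A.toLinearMap.isLinear v k

theorem fderiv_coord {F : Type*} [NormedAddCommGroup F] [NormedSpace ℝ F]
    {f : F → EuclideanSpace ℝ (Fin n)} {y : F} (hf : DifferentiableAt ℝ f y) (k : Fin n) (v : F) :
    fderiv ℝ (fun z => f z k) y v = fderiv ℝ f y v k := by
  have h := ((EuclideanSpace.proj (𝕜 := ℝ) k).hasFDerivAt.comp y hf.hasFDerivAt).fderiv
  exact DFunLike.congr_fun h v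

theorem isLinearMap_christoffelMap_left {E : Type*} [NormedAddCommGroup E] [NormedSpace ℝ E]
    (B : E → E →L[ℝ] E →L[ℝ] ℝ) (y w : E) : IsLinearMap ℝ fun v => christoffelMap B y v w where
  map_add v v' := by
    rw [christoffelMap, christoffelMap, christoffelMap, ← smul_add, ← map_add]
    refine congrArg (fun A => (1 / 2 : ℝ) • (B y).inverse A) (ContinuousLinearMap.ext fun z => ?_)
    simp only [koszulForm_apply, map_add, add_apply]
    ring
  map_smul c v := by
    rw [christoffelMap, christoffelMap, smul_comm, ← map_smul (B y).inverse c]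
    refine congrArg (fun A => (1 / 2 : ℝ) • (B y).inverse A) (ContinuousLinearMap.ext fun z => ?_)
    simp only [koszulForm_apply, map_smul, smul_apply, smul_eq_mul]
    ring

theorem isLinearMap_christoffelMap_right {E : Type*} [NormedAddCommGroup E] [NormedSpace ℝ E]
    (B : E → E →L[ℝ] E →L[ℝ] ℝ) (y v : E) : IsLinearMap ℝ fun w => christoffelMap B y v w where
  map_add v v' := by
    rw [christoffelMap, christoffelMap, christoffelMap, ← smul_add, ← map_add]
    refine congrArg (fun A => (1 / 2 : ℝ) • (B y).inverse A) (ContinuousLinearMap.ext fun z => ?_)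
    simp only [koszulForm_apply, map_add, add_apply]
    ring
  map_smul c v := by
    rw [christoffelMap, christoffelMap, smul_comm, ← map_smul (B y).inverse c]
    refine congrArg (fun A => (1 / 2 : ℝ) • (B y).inverse A) (ContinuousLinearMap.ext fun z => ?_)
    simp only [koszulForm_apply, map_smul, smul_apply, smul_eq_mul]
    ring

/-- Linearity in both arguments reduces the vanishing of `lieChristoffelMap` to basis vectors, where
the hypothesis on components applies. -/
theorem isLinearMap_lieChristoffelMap_left {E : Type*} [NormedAddCommGroup E] [NormedSpace ℝ E]
    [CompleteSpace E] {B : E → E →L[ℝ] E →L[ℝ] ℝ} (X : E → E) {y : E} (hB : ContDiffAt ℝ ∞ B y)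
    (hi : (B y).IsInvertible) (w : E) : IsLinearMap ℝ fun v => lieChristoffelMap X B y v w := by
  have hd (v w : E) : DifferentiableAt ℝ (fun z => christoffelMap B z v w) y :=
    (contDiffAt_christoffelMap hB hi v w).differentiableAt (by simp)
  constructor
  · intro v v'
    simp only [lieChristoffelMap, (isLinearMap_christoffelMap_left B _ _).map_add, map_add,
      fderiv_fun_add (hd v _) (hd v' _), add_apply]
    abel
  · intro c v
    simp only [lieChristoffelMap, (isLinearMap_christoffelMap_left B _ _).map_smul, map_smul,
      fderiv_fun_const_smul (hd v _), smul_apply, smul_add, smul_sub]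

theorem isLinearMap_lieChristoffelMap_right {E : Type*} [NormedAddCommGroup E] [NormedSpace ℝ E]
    [CompleteSpace E] {B : E → E →L[ℝ] E →L[ℝ] ℝ} (X : E → E) {y : E} (hB : ContDiffAt ℝ ∞ B y)
    (hi : (B y).IsInvertible) (v : E) : IsLinearMap ℝ fun w => lieChristoffelMap X B y v w := by
  have hd (v w : E) : DifferentiableAt ℝ (fun z => christoffelMap B z v w) y :=
    (contDiffAt_christoffelMap hB hi v w).differentiableAt (by simp)
  constructor
  · intro w w'
    simp only [lieChristoffelMap, (isLinearMap_christoffelMap_right B _ _).map_add, map_add,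
      fderiv_fun_add (hd _ w) (hd _ w'), add_apply]
    abel
  · intro c w
    simp only [lieChristoffelMap, (isLinearMap_christoffelMap_right B _ _).map_smul, map_smul,
      fderiv_fun_const_smul (hd _ w), smul_apply, smul_add, smul_sub]

section AtPoint

variable {X : ∀ x : M, TangentSpace (𝓡 n) x} {x : M}

theorem lieDerivChristoffel_eq
    (hX : ContDiffAt ℝ ∞ (fieldInChart (𝓡 n) X x) (extChartAt (𝓡 n) x x)) (h j i : Fin n) :
    lieDerivChristoffel g X x h j i
      = lieChristoffelMap (fieldInChart (𝓡 n) X x) (localMetric g x) (extChartAt (𝓡 n) x x)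
          (basisVec j) (basisVec i) h := by
  have hy := mem_extChartAt_target (I := 𝓡 n) x
  set y := extChartAt (𝓡 n) x x
  set Xc := fieldInChart (𝓡 n) X x
  have hB := contDiffAt_localMetric g x hy
  have hi' := localMetric_isInvertible g x hy
  have hd (v w : EuclideanSpace ℝ (Fin n)) :
      DifferentiableAt ℝ (fun z => christoffelMap (localMetric g x) z v w) y :=
    (contDiffAt_christoffelMap hB hi' v w).differentiableAt (by simp)
  have hXd : DifferentiableAt ℝ Xc y := hX.differentiableAt (by simp)
  have p1 (r : Fin n) : pderiv r (christoffel g x h j i) y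
      = fderiv ℝ (fun z => christoffelMap (localMetric g x) z (basisVec j) (basisVec i)) y
        (basisVec r) h := by
    rw [← fderiv_coord (hd _ _)]
    -- The components are differentiated, so their identification is needed on a neighbourhood and
    -- not only at `y`.
    have e : christoffel g x h j i =ᶠ[nhds y]
        fun z => christoffelMap (localMetric g x) z (basisVec j) (basisVec i) h := by
      filter_upwards [(isOpen_extChartAt_target (I := 𝓡 n) x).mem_nhds hy] with z hz
      exact christoffel_eq g x hz h j i
    exact DFunLike.congr_fun (e.fderiv_eq (𝕜 := ℝ)) _
  have p2 (r k : Fin n) : pderiv r (fun y => Xc y k) y = fderiv ℝ Xc y (basisVec r) k :=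
    fderiv_coord hXd k _
  have p3 : pderiv j (fun y => pderiv i (fun y => Xc y h) y) y
      = fderiv ℝ (fderiv ℝ Xc) y (basisVec j) (basisVec i) h := by
    have h1 : ContDiffAt ℝ 1 Xc y := hX.of_le (by exact_mod_cast le_top)
    have e : (fun z => pderiv i (fun y => Xc y h) z) =ᶠ[nhds y]
        fun z => fderiv ℝ Xc z (basisVec i) h := by
      filter_upwards [h1.eventually (by simp)] with z hz
      exact fderiv_coord (hz.differentiableAt (by simp)) h _
    have hD := differentiableAt_fderiv hX
    refine (DFunLike.congr_fun (e.fderiv_eq (𝕜 := ℝ)) _).trans ?_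
    rw [fderiv_coord (hD.clm_apply (differentiableAt_const _)), fderiv_clm_apply_const hD]
  have q (r s t : Fin n) := christoffel_eq g x hy r s t
  simp only [lieDerivChristoffel]
  change (∑ r, Xc y r * pderiv r (christoffel g x h j i) y)
    + pderiv j (fun y => pderiv i (fun y => Xc y h) y) y
    - (∑ r, christoffel g x r j i y * pderiv r (fun y => Xc y h) y)
    + (∑ r, christoffel g x h r i y * pderiv j (fun y => Xc y r) y)
    + (∑ r, christoffel g x h j r y * pderiv i (fun y => Xc y r) y) = _
  simp only [p1, p2, p3, q]
  rw [sum_coord_mul_clm, sum_coord_mul_clm]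
  simp only [mul_comm _ (fderiv ℝ Xc y _ _)]
  rw [sum_coord_mul _ (isLinearMap_christoffelMap_left _ _ _),
    sum_coord_mul _ (isLinearMap_christoffelMap_right _ _ _)]
  rfl

theorem lieChristoffelMap_eq_zero
    (hX : ContDiffAt ℝ ∞ (fieldInChart (𝓡 n) X x) (extChartAt (𝓡 n) x x))
    (hA : ∀ h j i : Fin n, lieDerivChristoffel g X x h j i = 0) (v w : EuclideanSpace ℝ (Fin n)) :
    lieChristoffelMap (fieldInChart (𝓡 n) X x) (localMetric g x) (extChartAt (𝓡 n) x x) v w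
      = 0 := by
  have hy := mem_extChartAt_target (I := 𝓡 n) x
  have hB := contDiffAt_localMetric g x hy
  have hi := localMetric_isInvertible g x hy
  ext h
  rw [← sum_coord_mul _ (isLinearMap_lieChristoffelMap_left _ hB hi w)]
  refine Finset.sum_eq_zero fun j _ => ?_
  rw [← sum_coord_mul _ (isLinearMap_lieChristoffelMap_right _ hB hi _),
    Finset.sum_eq_zero fun i _ => ?_, mul_zero]
  rw [← lieDerivChristoffel_eq g hX, hA, mul_zero]

theorem lieDerivTensor_eq (v w : EuclideanSpace ℝ (Fin n)) :
    lieDerivTensor (𝓡 n) X (fun q v w => g.inner q v w) x v w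
      = lieForm (fieldInChart (𝓡 n) X x) (localMetric g x) (extChartAt (𝓡 n) x x) v w := by
  have hy := mem_extChartAt_target (I := 𝓡 n) x
  have hB : DifferentiableAt ℝ (localMetric g x) (extChartAt (𝓡 n) x x) :=
    (contDiffAt_localMetric g x hy).differentiableAt (by simp)
  have e : fderiv ℝ (fun y => localMetric g x y v w) (extChartAt (𝓡 n) x x) (X x)
      = fderiv ℝ (localMetric g x) (extChartAt (𝓡 n) x x)
        (fieldInChart (𝓡 n) X x (extChartAt (𝓡 n) x x)) v w := by
    rw [fieldInChart_self]
    exact fderiv_clm_apply_const₂ hB v w _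
  exact congrArg₂ (· + ·) (congrArg₂ (· + ·) e (localMetric_self g x _ w).symm)
    (localMetric_self g x v _).symm

theorem tensorC_eq (u : EuclideanSpace ℝ (Fin n)) :
    tensorC g X x u
      = raisedLieForm (fieldInChart (𝓡 n) X x) (localMetric g x) (extChartAt (𝓡 n) x x) u := by
  have hy := mem_extChartAt_target (I := 𝓡 n) x
  have hB : DifferentiableAt ℝ (localMetric g x) (extChartAt (𝓡 n) x x) :=
    (contDiffAt_localMetric g x hy).differentiableAt (by simp)
  refine PiLp.ext (p := 2) (α := fun _ : Fin n => ℝ) fun h => ?_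
  -- The lowered endomorphism applied to `u`; symmetry of $L_Xg$ puts the free index first, as in
  -- `tensorC`.
  have e (m : Fin n) : localMetric g x (extChartAt (𝓡 n) x x) (raisedLieForm
      (fieldInChart (𝓡 n) X x) (localMetric g x) (extChartAt (𝓡 n) x x) u) (basisVec m)
      = -∑ k, u k * lieDerivTensor (𝓡 n) X (fun q v w => g.inner q v w) x (basisVec m)
          (basisVec k) := by
    rw [apply_raisedLieForm (localMetric_isInvertible g x hy), neg_apply,
      lieForm_symm hB (Filter.Eventually.of_forall fun z => localMetric_symm g x z)]
    simp only [lieDerivTensor_eq g]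
    conv_lhs => rw [← sum_coord_smul u]
    simp only [map_sum, map_smul, smul_eq_mul]
  rw [eq_inv_sum g x hy e]
  change ∑ k, (-∑ r, (metricMatrix g x (extChartAt (𝓡 n) x x))⁻¹ h r *
      lieDerivTensor (𝓡 n) X (fun q v w => g.inner q v w) x (basisVec r) (basisVec k)) * u k = _
  simp only [neg_mul, Finset.sum_neg_distrib, mul_neg, Finset.sum_mul, Finset.mul_sum]
  rw [Finset.sum_comm]
  refine congrArg _ (Finset.sum_congr rfl fun r _ => Finset.sum_congr rfl fun k _ => ?_)
  ring

theorem connectionMap_apply (x : M) (u : EuclideanSpace ℝ (Fin n))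
    (V : EuclideanSpace ℝ (Fin n) × EuclideanSpace ℝ (Fin n)) :
    connectionMap g (⟨x, u⟩ : TangentBundle (𝓡 n) M) V
      = V.2 + christoffelMap (localMetric g x) (extChartAt (𝓡 n) x x) V.1 u := by
  have hy := mem_extChartAt_target (I := 𝓡 n) x
  refine congrArg (fun a : EuclideanSpace ℝ (Fin n) => V.2 + a) ?_
  refine PiLp.ext (p := 2) (α := fun _ : Fin n => ℝ) fun k => ?_
  change ∑ i, (∑ j, christoffel g x k i j (extChartAt (𝓡 n) x x) * u j) * V.1 i = _
  rw [← sum_coord_mul _ (isLinearMap_christoffelMap_left _ _ _)]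
  refine Finset.sum_congr rfl fun i _ => ?_
  rw [← sum_coord_mul _ (isLinearMap_christoffelMap_right _ _ _), mul_comm]
  refine congrArg _ (Finset.sum_congr rfl fun j _ => ?_)
  rw [christoffel_eq g x hy, mul_comm]

/-- In $g(V_1,\Gamma(W_1,u))+g(\Gamma(V_1,u),W_1)$ the derivatives of `g` along `V.1` and `W.1`
cancel, and the two halves of the derivative along `u` add up to the first term of the complete
lift. -/
theorem gNaturalMetric_eq_metricLift {a₁ a₂ a₃ b₁ b₂ b₃ : ℝ → ℝ} {α β : ℝ}
    (ha₂ : ∀ t, 0 ≤ t → a₂ t = α) (hb₃ : ∀ t, 0 ≤ t → b₃ t = β)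
    (ha₁ : ∀ t, 0 ≤ t → a₁ t = 0) (ha₃ : ∀ t, 0 ≤ t → a₃ t = 0)
    (hb₁ : ∀ t, 0 ≤ t → b₁ t = 0) (hb₂ : ∀ t, 0 ≤ t → b₂ t = 0) (x : M)
    (u : EuclideanSpace ℝ (Fin n)) (V W : EuclideanSpace ℝ (Fin n) × EuclideanSpace ℝ (Fin n)) :
    gNaturalMetric g a₁ a₂ a₃ b₁ b₂ b₃ (⟨x, u⟩ : TangentBundle (𝓡 n) M) V W
      = metricLift (localMetric g x) α β (extChartAt (𝓡 n) x x, u) V W := by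
  have hy := mem_extChartAt_target (I := 𝓡 n) x
  have c (v w : EuclideanSpace ℝ (Fin n)) :
      g.inner x v w = localMetric g x (extChartAt (𝓡 n) x x) v w := (localMetric_self g x v w).symm
  -- The coefficient functions are prescribed only on $[0,\infty)$.
  have hu : 0 ≤ g.inner x u u := by
    rw [c]
    rcases eq_or_ne u 0 with h | h
    · rw [h, map_zero]
    · exact (localMetric_pos g x hy h).le
  have k (a b z : EuclideanSpace ℝ (Fin n)) := DFunLike.congr_fun
    (apply_christoffelMap (localMetric_isInvertible g x hy) a b) z
  simp only [smul_apply, koszulForm_apply, smul_eq_mul] at k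
  have s := fderiv_localMetric_symm g x hy
  have t := localMetric_symm g x (extChartAt (𝓡 n) x x)
  have expand {DD DK KD KK Vu Wu Ku Lu : ℝ} :
      ((a₁ (g.inner x u u) + a₃ (g.inner x u u)) * DD
        + (b₁ (g.inner x u u) + b₃ (g.inner x u u)) * Vu * Wu)
      + (a₂ (g.inner x u u) * DK + b₂ (g.inner x u u) * Vu * Ku)
      + (a₂ (g.inner x u u) * KD + b₂ (g.inner x u u) * Lu * Wu)
      + (a₁ (g.inner x u u) * KK + b₁ (g.inner x u u) * Lu * Ku)
      = β * (Vu * Wu) + α * (DK + KD) := by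
    rw [ha₁ _ hu, ha₂ _ hu, ha₃ _ hu, hb₁ _ hu, hb₂ _ hu, hb₃ _ hu]
    ring
  have kV := connectionMap_apply g x u V
  have kW := connectionMap_apply g x u W
  refine Eq.trans expand ?_
  rw [kV, kW]
  change β * (g.inner x V.1 u * g.inner x W.1 u)
    + α * (g.inner x V.1 (W.2 + (_ : EuclideanSpace ℝ (Fin n)) : EuclideanSpace ℝ (Fin n))
      + g.inner x (V.2 + (_ : EuclideanSpace ℝ (Fin n)) : EuclideanSpace ℝ (Fin n)) W.1) = _
  rw [c, c, c, c, map_add, map_add, add_apply, t V.1 (christoffelMap _ _ _ _), k, k, metricLift]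
  linear_combination (α / 2) * (s V.1 u W.1 + s W.1 u V.1 + s u W.1 V.1)

end AtPoint

end Components

/-! ### Induced charts of the tangent bundle and their transitions. -/

section TangentBundleCharts

variable {n : ℕ} {M : Type*} [TopologicalSpace M] [ChartedSpace (EuclideanSpace ℝ (Fin n)) M]
  [IsManifold (𝓡 n) ∞ M]

theorem extChartAt_tangent_apply (p q : TangentBundle (𝓡 n) M)
    (hq : q.proj ∈ (extChartAt (𝓡 n) p.proj).source) :
    extChartAt (𝓡 n).tangent p q = (extChartAt (𝓡 n) p.proj q.proj,
      (trivializationAt (EuclideanSpace ℝ (Fin n)) (TangentSpace (𝓡 n) : M → Type _)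
        p.proj).continuousLinearMapAt ℝ q.proj q.snd) := by
  have e := TangentBundle.continuousLinearMapAt_trivializationAt_eq_core (I := 𝓡 n)
    (b₀ := p.proj) (b := q.proj) (by rwa [← extChartAt_source (𝓡 n)])
  exact congrArg (Prod.mk _) (DFunLike.congr_fun e q.snd).symm

theorem mem_extChartAt_tangent_target (p : TangentBundle (𝓡 n) M)
    {Y : EuclideanSpace ℝ (Fin n) × EuclideanSpace ℝ (Fin n)} :
    Y ∈ (extChartAt (𝓡 n).tangent p).target ↔ Y.1 ∈ (extChartAt (𝓡 n) p.proj).target := by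
  have h := FiberBundle.extChartAt_target (IB := 𝓡 n) (F := EuclideanSpace ℝ (Fin n))
    (E := (TangentSpace (𝓡 n) : M → Type _)) p
  refine (Set.ext_iff.1 h Y).trans ⟨fun h => h.1.1, fun h => ⟨⟨h, ?_⟩, trivial⟩⟩
  change _ ∈ (chartAt (EuclideanSpace ℝ (Fin n)) p.proj).source
  rw [← extChartAt_source (𝓡 n)]
  exact (extChartAt (𝓡 n) p.proj).map_target h

theorem extChartAt_tangent_symm_apply (p : TangentBundle (𝓡 n) M)
    {y w : EuclideanSpace ℝ (Fin n)} (hy : y ∈ (extChartAt (𝓡 n) p.proj).target) :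
    (extChartAt (𝓡 n).tangent p).symm (y, w)
      = ⟨(extChartAt (𝓡 n) p.proj).symm y,
        (trivializationAt (EuclideanSpace ℝ (Fin n)) (TangentSpace (𝓡 n) : M → Type _)
          p.proj).symmL ℝ ((extChartAt (𝓡 n) p.proj).symm y) w⟩ := by
  have hs := (extChartAt (𝓡 n) p.proj).map_target hy
  have hb : (extChartAt (𝓡 n) p.proj).symm y ∈ (trivializationAt (EuclideanSpace ℝ (Fin n))
      (TangentSpace (𝓡 n) : M → Type _) p.proj).baseSet := by
    rwa [TangentBundle.trivializationAt_baseSet, ← extChartAt_source (𝓡 n)]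
  set q : TangentBundle (𝓡 n) M := ⟨(extChartAt (𝓡 n) p.proj).symm y,
        (trivializationAt (EuclideanSpace ℝ (Fin n)) (TangentSpace (𝓡 n) : M → Type _)
          p.proj).symmL ℝ ((extChartAt (𝓡 n) p.proj).symm y) w⟩ with hq
  have hqs : q ∈ (extChartAt (𝓡 n).tangent p).source := by
    rw [extChartAt_source]
    exact (TangentBundle.mem_chart_source_iff _ _).2 (by rwa [← extChartAt_source (𝓡 n)])
  have e : extChartAt (𝓡 n).tangent p q = (y, w) := by
    rw [extChartAt_tangent_apply p q hs]
    exact Prod.ext ((extChartAt (𝓡 n) p.proj).right_inv hy)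
      (Trivialization.continuousLinearMapAt_symmL (R := ℝ) _ hb w)
  rw [← e, (extChartAt (𝓡 n).tangent p).left_inv hqs]

theorem continuousLinearMapAt_symmL_eq_fderiv {x x' : M} {y : EuclideanSpace ℝ (Fin n)}
    (hy : y ∈ (extChartAt (𝓡 n) x).target)
    (hy' : (extChartAt (𝓡 n) x).symm y ∈ (extChartAt (𝓡 n) x').source)
    (w : EuclideanSpace ℝ (Fin n)) :
    (trivializationAt (EuclideanSpace ℝ (Fin n)) (TangentSpace (𝓡 n) : M → Type _)
        x').continuousLinearMapAt ℝ ((extChartAt (𝓡 n) x).symm y)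
      ((trivializationAt (EuclideanSpace ℝ (Fin n)) (TangentSpace (𝓡 n) : M → Type _) x).symmL ℝ
        ((extChartAt (𝓡 n) x).symm y) w)
      = fderiv ℝ (extChartAt (𝓡 n) x' ∘ (extChartAt (𝓡 n) x).symm) y w := by
  rw [← symmL_fderiv_transition hy hy']
  apply Trivialization.continuousLinearMapAt_symmL
  rwa [TangentBundle.trivializationAt_baseSet, ← extChartAt_source (𝓡 n)]

theorem extChartAt_tangent_transition (p p' : TangentBundle (𝓡 n) M)
    {y : EuclideanSpace ℝ (Fin n)} (hy : y ∈ (extChartAt (𝓡 n) p.proj).target)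
    (hy' : (extChartAt (𝓡 n) p.proj).symm y ∈ (extChartAt (𝓡 n) p'.proj).source)
    (w : EuclideanSpace ℝ (Fin n)) :
    (extChartAt (𝓡 n).tangent p' ∘ (extChartAt (𝓡 n).tangent p).symm) (y, w)
      = ((extChartAt (𝓡 n) p'.proj ∘ (extChartAt (𝓡 n) p.proj).symm) y,
        fderiv ℝ (extChartAt (𝓡 n) p'.proj ∘ (extChartAt (𝓡 n) p.proj).symm) y w) := by
  rw [Function.comp_apply, extChartAt_tangent_symm_apply p hy, extChartAt_tangent_apply p' _ hy']
  exact congrArg (Prod.mk _) (continuousLinearMapAt_symmL_eq_fderiv hy hy' w)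

/-- The transition is `(y, w) ↦ (φ y, fderiv ℝ φ y w)` near the point; its differential has the form
appearing in `metricLift_pullback` and `fieldLift_pushforward`. -/
theorem fderiv_extChartAt_tangent_transition (p p' : TangentBundle (𝓡 n) M)
    {y : EuclideanSpace ℝ (Fin n)} (hy : y ∈ (extChartAt (𝓡 n) p.proj).target)
    (hy' : (extChartAt (𝓡 n) p.proj).symm y ∈ (extChartAt (𝓡 n) p'.proj).source)
    (w : EuclideanSpace ℝ (Fin n)) (V : EuclideanSpace ℝ (Fin n) × EuclideanSpace ℝ (Fin n)) :
    fderiv ℝ (extChartAt (𝓡 n).tangent p' ∘ (extChartAt (𝓡 n).tangent p).symm) (y, w) V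
      = (fderiv ℝ (extChartAt (𝓡 n) p'.proj ∘ (extChartAt (𝓡 n) p.proj).symm) y V.1,
        fderiv ℝ (fderiv ℝ (extChartAt (𝓡 n) p'.proj ∘ (extChartAt (𝓡 n) p.proj).symm)) y V.1 w
        + fderiv ℝ (extChartAt (𝓡 n) p'.proj ∘ (extChartAt (𝓡 n) p.proj).symm) y V.2) := by
  have hφ := contDiffAt_transition hy hy'
  have hev := eventually_mem_transition (isOpen_extChartAt_source (I := 𝓡 n) p'.proj) hy hy'
  set φ := extChartAt (𝓡 n) p'.proj ∘ (extChartAt (𝓡 n) p.proj).symm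
  have hφd : DifferentiableAt ℝ φ y := hφ.differentiableAt (by simp)
  have hD := differentiableAt_fderiv hφ
  have hf : DifferentiableAt ℝ (Prod.fst : EuclideanSpace ℝ (Fin n) × EuclideanSpace ℝ (Fin n) →
    EuclideanSpace ℝ (Fin n)) (y, w) := differentiableAt_fst
  have e : extChartAt (𝓡 n).tangent p' ∘ (extChartAt (𝓡 n).tangent p).symm =ᶠ[nhds (y, w)]
      fun Y => (φ Y.1, fderiv ℝ φ Y.1 Y.2) := by
    filter_upwards [continuousAt_fst.eventually hev] with Y hY
    exact extChartAt_tangent_transition p p' hY.1 hY.2 Y.2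
  have h1 : DifferentiableAt ℝ (fun Y : EuclideanSpace ℝ (Fin n) × EuclideanSpace ℝ (Fin n) =>
      φ Y.1) (y, w) := DifferentiableAt.comp (y, w) (g := φ) (f := Prod.fst) hφd hf
  have h2 : DifferentiableAt ℝ (fun Y : EuclideanSpace ℝ (Fin n) × EuclideanSpace ℝ (Fin n) =>
      fderiv ℝ φ Y.1) (y, w) :=
    DifferentiableAt.comp (y, w) (g := fderiv ℝ φ) (f := Prod.fst) hD hf
  refine (DFunLike.congr_fun (e.fderiv_eq (𝕜 := ℝ)) V).trans ?_
  rw [DifferentiableAt.fderiv_prodMk h1 (h2.clm_apply differentiableAt_snd),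
    fderiv_clm_apply h2 differentiableAt_snd]
  simp [fderiv_comp_fst hφd, fderiv_comp_fst hD, fderiv_snd, add_comm]

end TangentBundleCharts

/-! ### Chart expressions of the metric and of the lifted field, and the conclusion. -/

section Lift

variable {n : ℕ} {M : Type*} [TopologicalSpace M] [ChartedSpace (EuclideanSpace ℝ (Fin n)) M]
  [IsManifold (𝓡 n) ∞ M]
  (g : ContMDiffRiemannianMetric (𝓡 n) ∞ (EuclideanSpace ℝ (Fin n))
      (TangentSpace (𝓡 n) : M → Type _))

theorem iotaLift_add_completeLift_eq_fieldLift (X : ∀ x : M, TangentSpace (𝓡 n) x) (x : M)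
    (u : EuclideanSpace ℝ (Fin n)) :
    iotaLift (tensorC g X) (⟨x, u⟩ : TangentBundle (𝓡 n) M) + completeLift X ⟨x, u⟩
      = fieldLift (fieldInChart (𝓡 n) X x) (localMetric g x) (extChartAt (𝓡 n) x x, u) := by
  refine Prod.ext ?_ ?_
  · exact (zero_add (X x)).trans (fieldInChart_self X x).symm
  · exact congrArg (fun a : EuclideanSpace ℝ (Fin n) => a + _) (tensorC_eq g u)

theorem symm_tangent_eq (p : TangentBundle (𝓡 n) M) {y w : EuclideanSpace ℝ (Fin n)}
    (hy : y ∈ (extChartAt (𝓡 n) p.proj).target) :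
    (extChartAt (𝓡 n).tangent p).symm (y, w) = ⟨(extChartAt (𝓡 n) p.proj).symm y,
      fderiv ℝ (extChartAt (𝓡 n) ((extChartAt (𝓡 n) p.proj).symm y)
        ∘ (extChartAt (𝓡 n) p.proj).symm) y w⟩ := by
  rw [extChartAt_tangent_symm_apply p hy]
  exact congrArg _ (DFunLike.congr_fun (symmL_eq_fderiv hy) w)

/-- At the base point `r` over `y` the metric is known in the chart at `r`; `metricLift_pullback`
along the transition `φ` carries that formula back to the chart at `p`. -/
theorem tensorInChart_gNaturalMetric {a₁ a₂ a₃ b₁ b₂ b₃ : ℝ → ℝ} {α β : ℝ}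
    (ha₂ : ∀ t, 0 ≤ t → a₂ t = α) (hb₃ : ∀ t, 0 ≤ t → b₃ t = β)
    (ha₁ : ∀ t, 0 ≤ t → a₁ t = 0) (ha₃ : ∀ t, 0 ≤ t → a₃ t = 0)
    (hb₁ : ∀ t, 0 ≤ t → b₁ t = 0) (hb₂ : ∀ t, 0 ≤ t → b₂ t = 0) (p : TangentBundle (𝓡 n) M)
    {y : EuclideanSpace ℝ (Fin n)} (hy : y ∈ (extChartAt (𝓡 n) p.proj).target)
    (w : EuclideanSpace ℝ (Fin n)) (V W : EuclideanSpace ℝ (Fin n) × EuclideanSpace ℝ (Fin n)) :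
    tensorInChart (𝓡 n).tangent (gNaturalMetric g a₁ a₂ a₃ b₁ b₂ b₃) p (y, w) V W
      = metricLift (localMetric g p.proj) α β (y, w) V W := by
  have hY : (y, w) ∈ (extChartAt (𝓡 n).tangent p).target := (mem_extChartAt_tangent_target p).2 hy
  have hsym := symmL_eq_fderiv hY
  have hq := symm_tangent_eq p (w := w) hy
  set r := (extChartAt (𝓡 n) p.proj).symm y
  have hy' : r ∈ (extChartAt (𝓡 n) r).source := mem_extChartAt_source r
  have hφ := contDiffAt_transition hy hy'
  have hev := eventually_mem_transition (isOpen_extChartAt_source (I := 𝓡 n) r) hy hy'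
  have hD := fderiv_extChartAt_tangent_transition p
    (⟨r, fderiv ℝ (extChartAt (𝓡 n) r ∘ (extChartAt (𝓡 n) p.proj).symm) y w⟩) hy hy' w
  set φ := extChartAt (𝓡 n) r ∘ (extChartAt (𝓡 n) p.proj).symm
  have hφy : φ y = extChartAt (𝓡 n) r r := rfl
  refine Eq.trans ?_ (metricLift_pullback (B' := localMetric g r) hφ
    ((contDiffAt_localMetric g p.proj hy).differentiableAt (by simp))
    ((contDiffAt_localMetric g r (hφy ▸ mem_extChartAt_target r)).differentiableAt (by simp))
    (hev.mono fun z hz => localMetric_transition g hz.1 hz.2) α β w V W)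
  rw [hφy, ← gNaturalMetric_eq_metricLift g ha₂ hb₃ ha₁ ha₃ hb₁ hb₂, ← hD V, ← hD W,
    tensorInChart, hsym, hq]
  rfl

theorem fieldInChart_iotaLift_add_completeLift {X : ∀ x : M, TangentSpace (𝓡 n) x}
    (p : TangentBundle (𝓡 n) M) {y : EuclideanSpace ℝ (Fin n)}
    (hy : y ∈ (extChartAt (𝓡 n) p.proj).target)
    (hX : ContMDiffAt (𝓡 n) (𝓡 n).tangent ∞ (fun x => (⟨x, X x⟩ : TangentBundle (𝓡 n) M))
      ((extChartAt (𝓡 n) p.proj).symm y)) (w : EuclideanSpace ℝ (Fin n)) :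
    fieldInChart (𝓡 n).tangent (fun p => iotaLift (tensorC g X) p + completeLift X p) p (y, w)
      = fieldLift (fieldInChart (𝓡 n) X p.proj) (localMetric g p.proj) (y, w) := by
  have hs := (extChartAt (𝓡 n) p.proj).map_target hy
  have hY : (y, w) ∈ (extChartAt (𝓡 n).tangent p).target := (mem_extChartAt_tangent_target p).2 hy
  have hsym := symmL_eq_fderiv hY
  have hq := symm_tangent_eq p (w := w) hy
  have hX1 := (contMDiffAt_iff_contDiffAt_fieldInChart hy).1 hX
  -- This derivative is the inverse of a fibre trivialization.
  have hsurj : Function.Surjective (fderiv ℝ (extChartAt (𝓡 n) ((extChartAt (𝓡 n) p.proj).symm y)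
      ∘ (extChartAt (𝓡 n) p.proj).symm) y) := by
    intro v
    have hb : (extChartAt (𝓡 n) p.proj).symm y ∈ (trivializationAt (EuclideanSpace ℝ (Fin n))
        (TangentSpace (𝓡 n) : M → Type _) p.proj).baseSet := by
      rwa [TangentBundle.trivializationAt_baseSet, ← extChartAt_source (𝓡 n)]
    exact ⟨_, (DFunLike.congr_fun (symmL_eq_fderiv hy) _).symm.trans
      (Trivialization.symmL_continuousLinearMapAt (R := ℝ) _ hb v)⟩
  set r := (extChartAt (𝓡 n) p.proj).symm y
  have hy' : r ∈ (extChartAt (𝓡 n) r).source := mem_extChartAt_source r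
  have hX2 : ContDiffAt ℝ ∞ (fieldInChart (𝓡 n) X r) (extChartAt (𝓡 n) r r) := by
    rw [← contMDiffAt_iff_contDiffAt_fieldInChart (mem_extChartAt_target r), extChartAt_to_inv]
    exact hX
  have hφ := contDiffAt_transition hy hy'
  have hev := eventually_mem_transition (isOpen_extChartAt_source (I := 𝓡 n) r) hy hy'
  have hD := fderiv_extChartAt_tangent_transition p
    (⟨r, fderiv ℝ (extChartAt (𝓡 n) r ∘ (extChartAt (𝓡 n) p.proj).symm) y w⟩) hy hy' w
  set φ := extChartAt (𝓡 n) r ∘ (extChartAt (𝓡 n) p.proj).symm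
  have hφy : φ y = extChartAt (𝓡 n) r r := rfl
  have ht : φ y ∈ (extChartAt (𝓡 n) r).target := hφy ▸ mem_extChartAt_target r
  have h1 := fieldLift_pushforward (B' := localMetric g r) (X' := fieldInChart (𝓡 n) X r) hφ
    ((contDiffAt_localMetric g p.proj hy).differentiableAt (by simp))
    ((contDiffAt_localMetric g r ht).differentiableAt (by simp))
    (hX1.differentiableAt (by simp)) (hφy ▸ hX2.differentiableAt (by simp))
    (hev.mono fun z hz => localMetric_transition g hz.1 hz.2)
    (hev.mono fun z hz => fieldInChart_transition X hz.1 hz.2)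
    (localMetric_isInvertible g p.proj hy) (localMetric_isInvertible g r ht) hsurj w
  rw [hφy, ← iotaLift_add_completeLift_eq_fieldLift g X r, ← hD] at h1
  refine fieldInChart_eq_of_symmL_eq hY ?_
  rw [hsym, hq]
  exact h1.symm

theorem extChartAt_tangent_self (x : M) (u : EuclideanSpace ℝ (Fin n)) :
    extChartAt (𝓡 n).tangent (⟨x, u⟩ : TangentBundle (𝓡 n) M) ⟨x, u⟩
      = (extChartAt (𝓡 n) x x, u) := by
  rw [extChartAt_tangent_apply ⟨x, u⟩ ⟨x, u⟩ (mem_extChartAt_source (I := 𝓡 n) x)]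
  have e := continuousLinearMapAt_self (I := 𝓡 n) x u
  exact congrArg (Prod.mk (extChartAt (𝓡 n) x x)) e

section OpenSet

variable {U : Set M} {X : ∀ x : M, TangentSpace (𝓡 n) x} {x : M}

theorem contDiffAt_fieldInChart_self (hU : IsOpen U)
    (hX : ContMDiffOn (𝓡 n) (𝓡 n).tangent ∞ (fun x => (⟨x, X x⟩ : TangentBundle (𝓡 n) M)) U)
    (hx : x ∈ U) : ContDiffAt ℝ ∞ (fieldInChart (𝓡 n) X x) (extChartAt (𝓡 n) x x) := by
  rw [← contMDiffAt_iff_contDiffAt_fieldInChart (mem_extChartAt_target x), extChartAt_to_inv]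
  exact hX.contMDiffAt (hU.mem_nhds hx)

/-- The Lie derivative involves the derivative of the components, so equality near the point is
required; openness of `U` keeps `X` smooth at the nearby points. -/
theorem fieldInChart_eventuallyEq_fieldLift (hU : IsOpen U)
    (hX : ContMDiffOn (𝓡 n) (𝓡 n).tangent ∞ (fun x => (⟨x, X x⟩ : TangentBundle (𝓡 n) M)) U)
    (hx : x ∈ U) (u : EuclideanSpace ℝ (Fin n)) :
    fieldInChart (𝓡 n).tangent (fun p => iotaLift (tensorC g X) p + completeLift X p)
        (⟨x, u⟩ : TangentBundle (𝓡 n) M)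
      =ᶠ[nhds (extChartAt (𝓡 n) x x, u)]
        fieldLift (fieldInChart (𝓡 n) X x) (localMetric g x) := by
  have hev := eventually_mem_transition hU (mem_extChartAt_target (I := 𝓡 n) x)
    (by rwa [extChartAt_to_inv])
  filter_upwards [continuousAt_fst.eventually hev] with Y hY
  exact fieldInChart_iotaLift_add_completeLift g ⟨x, u⟩ hY.1
    (hX.contMDiffAt (hU.mem_nhds hY.2)) Y.2

theorem contMDiffAt_iotaLift_add_completeLift (hU : IsOpen U)
    (hX : ContMDiffOn (𝓡 n) (𝓡 n).tangent ∞ (fun x => (⟨x, X x⟩ : TangentBundle (𝓡 n) M)) U)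
    (hx : x ∈ U) (u : EuclideanSpace ℝ (Fin n)) :
    ContMDiffAt (𝓡 n).tangent (𝓡 n).tangent.tangent ∞
      (fun p : TangentBundle (𝓡 n) M => (⟨p, iotaLift (tensorC g X) p + completeLift X p⟩ :
        TangentBundle (𝓡 n).tangent (TangentBundle (𝓡 n) M))) ⟨x, u⟩ := by
  have hy := mem_extChartAt_target (I := 𝓡 n) x
  have h := contMDiffAt_iff_contDiffAt_fieldInChart (I := (𝓡 n).tangent)
    (Z := fun p : TangentBundle (𝓡 n) M => iotaLift (tensorC g X) p + completeLift X p)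
    (mem_extChartAt_target (I := (𝓡 n).tangent) (⟨x, u⟩ : TangentBundle (𝓡 n) M))
  rw [extChartAt_to_inv, extChartAt_tangent_self] at h
  exact h.2 ((contDiffAt_fieldLift (contDiffAt_localMetric g x hy)
    (contDiffAt_fieldInChart_self hU hX hx) (localMetric_isInvertible g x hy)).congr_of_eventuallyEq
      (fieldInChart_eventuallyEq_fieldLift g hU hX hx u))

theorem lieDerivTensor_gNaturalMetric_eq_zero (hU : IsOpen U)
    (hX : IsInfinitesimalAffineOn g X U) {a₁ a₂ a₃ b₁ b₂ b₃ : ℝ → ℝ} {α β : ℝ}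
    (ha₂ : ∀ t, 0 ≤ t → a₂ t = α) (hb₃ : ∀ t, 0 ≤ t → b₃ t = β)
    (ha₁ : ∀ t, 0 ≤ t → a₁ t = 0) (ha₃ : ∀ t, 0 ≤ t → a₃ t = 0)
    (hb₁ : ∀ t, 0 ≤ t → b₁ t = 0) (hb₂ : ∀ t, 0 ≤ t → b₂ t = 0)
    (hx : x ∈ U) (u : EuclideanSpace ℝ (Fin n))
    (V W : EuclideanSpace ℝ (Fin n) × EuclideanSpace ℝ (Fin n)) :
    lieDerivTensor (𝓡 n).tangent (fun p => iotaLift (tensorC g X) p + completeLift X p)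
      (gNaturalMetric g a₁ a₂ a₃ b₁ b₂ b₃) (⟨x, u⟩ : TangentBundle (𝓡 n) M) V W = 0 := by
  have hy := mem_extChartAt_target (I := 𝓡 n) x
  have hX1 := contDiffAt_fieldInChart_self hU hX.1 hx
  have key := lieDeriv_metricLift_eq_zero (contDiffAt_localMetric g x hy) hX1
    (localMetric_isInvertible g x hy)
    (Filter.Eventually.of_forall fun z => localMetric_symm g x z)
    (lieChristoffelMap_eq_zero g hX1 (hX.2 x hx)) α β u V W
  have hG := gNaturalMetric_eq_metricLift g ha₂ hb₃ ha₁ ha₃ hb₁ hb₂ x u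
  have hT : (fun Y => tensorInChart (𝓡 n).tangent (gNaturalMetric g a₁ a₂ a₃ b₁ b₂ b₃)
      (⟨x, u⟩ : TangentBundle (𝓡 n) M) Y V W) =ᶠ[nhds (extChartAt (𝓡 n) x x, u)]
      fun Y => metricLift (localMetric g x) α β Y V W := by
    filter_upwards [continuousAt_fst.eventually
      ((isOpen_extChartAt_target (I := 𝓡 n) x).mem_nhds hy)] with Y hY
    exact tensorInChart_gNaturalMetric g ha₂ hb₃ ha₁ ha₃ hb₁ hb₂ ⟨x, u⟩ hY Y.2 V W
  have hf := fieldInChart_eventuallyEq_fieldLift g hU hX.1 hx u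
  have hZ := iotaLift_add_completeLift_eq_fieldLift g X x u
  -- Undifferentiated factors need only the pointwise formulas `hG` and `hZ`; the differentiated
  -- ones use the equalities of germs `hT` and `hf`.
  rw [← hG, ← hG, ← hT.fderiv_eq, ← hf.fderiv_eq, ← hZ, ← extChartAt_tangent_self] at key
  exact key

end OpenSet

end Lift

end GNat

theorem mainTheorem9 {n : ℕ} {M : Type*} [TopologicalSpace M] [T2Space M]
    [ChartedSpace (EuclideanSpace ℝ (Fin n)) M] [IsManifold (𝓡 n) ∞ M]
    (g : ContMDiffRiemannianMetric (𝓡 n) ∞ (EuclideanSpace ℝ (Fin n))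
      (TangentSpace (𝓡 n) : M → Type _))
    (U : Set M) (hU : IsOpen U)
    (X : ∀ x : M, TangentSpace (𝓡 n) x) (hX : GNat.IsInfinitesimalAffineOn g X U)
    (a₁ a₂ a₃ b₁ b₂ b₃ : ℝ → ℝ) (α β : ℝ) (hα : α ≠ 0)
    (ha₂ : ∀ t, 0 ≤ t → a₂ t = α) (hb₃ : ∀ t, 0 ≤ t → b₃ t = β)
    (ha₁ : ∀ t, 0 ≤ t → a₁ t = 0) (ha₃ : ∀ t, 0 ≤ t → a₃ t = 0)
    (hb₁ : ∀ t, 0 ≤ t → b₁ t = 0) (hb₂ : ∀ t, 0 ≤ t → b₂ t = 0) :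
    GNat.IsKillingOn (𝓡 n).tangent (GNat.gNaturalMetric g a₁ a₂ a₃ b₁ b₂ b₃)
      (fun p => GNat.iotaLift (GNat.tensorC g X) p + GNat.completeLift X p)
      (TotalSpace.proj ⁻¹' U : Set (TangentBundle (𝓡 n) M)) := by
  refine ⟨fun p hp => ?_, fun p hp V W => ?_⟩
  · exact (GNat.contMDiffAt_iotaLift_add_completeLift g hU hX.1 hp p.snd).contMDiffWithinAt
  · exact GNat.lieDerivTensor_gNaturalMetric_eq_zero g hU hX ha₂ hb₃ ha₁ ha₃ hb₁ hb₂ hp p.snd V W
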